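/- Let $G$ be a finite simple planar graph with maximum degree $\Delta$ that contains no cycle of length $5$ (as a subgraph, induced or not). Then $G$ is edge-$(\Delta+2)$-group choosable, that is, its line graph $\ell(G)$ is $(\Delta+2)$-group choosable. Here a graph $H$ is called $k$-group choosable if the following holds for every Abelian group $A$ of order at least $k$ and every assignment $L$ of a list $L(v)\subseteq A$ with $|L(v)|=k$ to each vertex $v$ of $H$: for every orientation of $H$ and every function $f:E(H)\to A$ there is a map $c:V(H)\to A$ with $c(v)\in L(v)$ for all $v\in V(H)$ and $c(x)-c(y)\neq f(xy)$ for every edge $xy$ of $H$ directed from $x$ to $y$. -/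

import Mathlib

universe u w

/-! ### Plane drawings and planar graphs -/

/-- A simple polygonal arc in the Euclidean plane: `n` non-degenerate straight line segments, joined
end to end, with no further intersections, so that their union is homeomorphic to `[0, 1]`. -/
structure PolygonalArc where
  /-- the number of segments -/
  n : ℕ
  /-- the successive corners, the two ends included -/
  corner : Fin (n + 1) → EuclideanSpace ℝ (Fin 2)
  nondegenerate : ∀ i : Fin n, corner i.castSucc ≠ corner i.succ
  simple : ∀ i j : Fin n, i < j → ∀ x,
    x ∈ segment ℝ (corner i.castSucc) (corner i.succ) →
    x ∈ segment ℝ (corner j.castSucc) (corner j.succ) →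
    i.succ = j.castSucc ∧ x = corner i.succ

namespace PolygonalArc

/-- The first end of the arc. -/
def start (γ : PolygonalArc) : EuclideanSpace ℝ (Fin 2) := γ.corner 0

/-- The last end of the arc. -/
def finish (γ : PolygonalArc) : EuclideanSpace ℝ (Fin 2) := γ.corner (Fin.last γ.n)

/-- The set of points of the plane that lie on the arc. -/
def carrier (γ : PolygonalArc) : Set (EuclideanSpace ℝ (Fin 2)) :=
  ⋃ i : Fin γ.n, segment ℝ (γ.corner i.castSucc) (γ.corner i.succ)

end PolygonalArc

namespace SimpleGraph

/-- A drawing of `G` in the Euclidean plane without crossings: distinct vertices are distinct points,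
every edge is a simple polygonal arc between its two ends, an edge passes through no vertex other
than its ends, and two edges have no point in common other than a common end. -/
structure PlaneDrawing {V : Type*} (G : SimpleGraph V) where
  pos : V → EuclideanSpace ℝ (Fin 2)
  pos_injective : Function.Injective pos
  arc : G.edgeSet → PolygonalArc
  ends_arc : ∀ e : G.edgeSet, s((arc e).start, (arc e).finish) = Sym2.map pos (e : Sym2 V)
  mem_of_pos_mem : ∀ (e : G.edgeSet) (v : V), pos v ∈ (arc e).carrier → v ∈ (e : Sym2 V)
  inter_arc : ∀ e e' : G.edgeSet, e ≠ e' → ∀ x, x ∈ (arc e).carrier → x ∈ (arc e').carrier →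
    ∃ v : V, v ∈ (e : Sym2 V) ∧ v ∈ (e' : Sym2 V) ∧ x = pos v

/-- A graph is planar if it can be drawn in the Euclidean plane without crossings. -/
def IsPlanar {V : Type*} (G : SimpleGraph V) : Prop := Nonempty G.PlaneDrawing

/-! ### Group choosability -/

/-- `D` orients `G`: every `D x y` is an edge of `G`, directed from `x` to `y`, and every edge of `G`
gets exactly one of its two directions. -/
def IsOrientation {V : Type*} (G : SimpleGraph V) (D : V → V → Prop) : Prop :=
  (∀ x y, D x y → G.Adj x y) ∧ ∀ x y, G.Adj x y → (D x y ↔ ¬ D y x)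

/-- `c` is an `(A, L, f)`-colouring of `G` under the orientation `D`: the colours come from the lists,
and `c x - c y ≠ f (xy)` for each edge directed from `x` to `y`. -/
def IsGroupListColoring {V : Type*} (G : SimpleGraph V) (D : V → V → Prop) {A : Type*}
    [AddCommGroup A] (L : V → Finset A) (f : G.edgeSet → A) (c : V → A) : Prop :=
  (∀ v, c v ∈ L v) ∧
    ∀ (x y : V) (h : G.Adj x y), D x y → c x - c y ≠ f ⟨s(x, y), G.mem_edgeSet.mpr h⟩

/-- `G` is `(A, L)`-colourable: under every orientation, each `f : E(G) → A` admits an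
`(A, L, f)`-colouring. -/
def IsGroupListColorable {V : Type*} (G : SimpleGraph V) {A : Type*} [AddCommGroup A]
    (L : V → Finset A) : Prop :=
  ∀ D : V → V → Prop, G.IsOrientation D →
    ∀ f : G.edgeSet → A, ∃ c : V → A, G.IsGroupListColoring D L f c

/-- `G` is `k`-group choosable: it is `(A, L)`-colourable for each Abelian group `A`, finite or
infinite, of order at least `k`, and each assignment `L` of lists of exactly `k` elements of `A`. -/
def IsGroupChoosable {V : Type u} (G : SimpleGraph V) (k : ℕ) : Prop :=
  ∀ (A : Type w) [AddCommGroup A], (k : ℕ∞) ≤ ENat.card A →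
    ∀ L : V → Finset A, (∀ v, (L v).card = k) → G.IsGroupListColorable L

/-- `G` is edge-`k`-group choosable if its line graph is `k`-group choosable. -/
def IsEdgeGroupChoosable {V : Type u} (G : SimpleGraph V) (k : ℕ) : Prop :=
  IsGroupChoosable.{u, w} G.lineGraph k

end SimpleGraph

/-! The line graph is coloured greedily. A neighbour that already has its colour forbids one element
of a list, whatever the orientation and `f`, so it suffices that every nonempty set of edges
contains an edge meeting at most Δ + 1 others of the set. Planarity and the absence of 5-cycles pass
to subgraphs, so this follows once every such graph with an edge has a vertex v of degree 1, 2 or 3: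
an edge vw then meets at most 2 others at v and Δ - 1 at w.

The vertex of low degree comes from discharging. If all non-isolated vertices had degree at least 4,
give each dart the charges 1 - 4/(degree of its tail) and 1 - 4/(length of its face). The total is
4(E - V - F), which is negative by Euler's inequality E + 1 ≤ V + F. But without 5-cycles no face
has length 5, a triangle borders only triangles and faces of length at least 6, and no three
consecutive corners at a vertex are triangular. Averaging the face charges over the two sides of
each edge, and then over pairs of edges at a vertex, makes every local contribution nonnegative
(`MinFour.sum_charge_nonneg`).

Euler's inequality is proved without the Jordan curve theorem (`PlaneDrawing.euler`). An integer
circulation on the edges has a winding number on each side of each edge; it is constant along a face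
and jumps by the weight of the edge across it. The circulations, of rank at least E - (V - 1),
therefore embed in the integer functions on the faces. -/

namespace Equiv.Perm

/-! ### Counting the cycles of a permutation -/

variable {α : Type*} [Fintype α]

/-- The minimal period of a point is the size of its cycle. -/
theorem card_sameCycle_eq_minimalPeriod [DecidableEq α] (f : Perm α) (x : α)
    [DecidablePred (f.SameCycle x)] :
    (Finset.univ.filter (f.SameCycle x)).card = Function.minimalPeriod f x := by
  have hpos : 0 < Function.minimalPeriod f x :=
    Function.minimalPeriod_pos_of_mem_periodicPts
      (Function.Injective.mem_periodicPts f.injective x)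
  rw [← Finset.card_range (Function.minimalPeriod f x), eq_comm,
    ← Finset.card_image_of_injOn (f := fun i => f^[i] x)]
  · congr 1
    ext y
    simp only [Finset.mem_image, Finset.mem_range, Finset.mem_filter, Finset.mem_univ, true_and]
    constructor
    · rintro ⟨i, -, rfl⟩
      exact ⟨i, by simp [iterate_eq_pow]⟩
    · intro h
      obtain ⟨i, hi⟩ := h.exists_nat_pow_eq
      refine ⟨i % Function.minimalPeriod f x, Nat.mod_lt _ hpos, ?_⟩
      rw [Function.iterate_mod_minimalPeriod_eq, iterate_eq_pow, hi]
  · intro i hi j hj h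
    exact Function.iterate_injOn_Iio_minimalPeriod (by simpa using hi) (by simpa using hj) h

/-- Summing the reciprocal of the minimal period counts the cycles. -/
theorem sum_one_div_minimalPeriod (f : Perm α) :
    ∑ x, (1 / (Function.minimalPeriod f x : ℚ)) =
      Nat.card (Quotient (SameCycle.setoid f)) := by
  classical
  have : Fintype (Quotient (SameCycle.setoid f)) := Fintype.ofFinite _
  rw [Nat.card_eq_fintype_card, ← Finset.card_univ, Finset.card_eq_sum_ones, Nat.cast_sum,
    ← Finset.sum_fiberwise (s := Finset.univ) (g := fun x => (Quotient.mk (SameCycle.setoid f) x))]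
  refine Finset.sum_congr rfl fun q _ => ?_
  induction q using Quotient.inductionOn with
  | h a =>
  have hfil : (Finset.univ.filter fun x => (Quotient.mk (SameCycle.setoid f) x) = ⟦a⟧) =
      Finset.univ.filter (f.SameCycle a) := by
    ext x
    simp only [Finset.mem_filter, Finset.mem_univ, true_and]
    exact Quotient.eq.trans ⟨fun h => SameCycle.symm h, fun h => SameCycle.symm h⟩
  rw [hfil]
  have hc : ∀ x ∈ Finset.univ.filter (f.SameCycle a),
      (1 / (Function.minimalPeriod f x : ℚ)) = 1 / (Function.minimalPeriod f a : ℚ) := by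
    intro x hx
    have hx' : f.SameCycle a x := by simpa using hx
    rw [← card_sameCycle_eq_minimalPeriod f x, ← card_sameCycle_eq_minimalPeriod f a]
    congr 3
    ext y
    simp only [Finset.mem_filter, Finset.mem_univ, true_and]
    exact ⟨fun h => hx'.trans h, fun h => hx'.symm.trans h⟩
  rw [Finset.sum_congr rfl hc, Finset.sum_const, card_sameCycle_eq_minimalPeriod]
  have hpos : 0 < Function.minimalPeriod f a :=
    Function.minimalPeriod_pos_of_mem_periodicPts
      (Function.Injective.mem_periodicPts f.injective a)
  have : (Function.minimalPeriod f a : ℚ) ≠ 0 := by positivity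
  simp [this]

end Equiv.Perm

/-! ### Rotation systems, and the faces around a vertex when there is no 5-cycle -/

namespace SimpleGraph

open Function

variable {V : Type*} {G : SimpleGraph V}

/-- `G` has no cycle of length five. -/
def NoFiveCycle (G : SimpleGraph V) : Prop :=
  ∀ (v : V) (p : G.Walk v v), p.IsCycle → p.length ≠ 5

theorem NoFiveCycle.false_of_adj (h5 : G.NoFiveCycle) {a b c d e : V}
    (hab : G.Adj a b) (hbc : G.Adj b c) (hcd : G.Adj c d) (hde : G.Adj d e) (hea : G.Adj e a)
    (hac : a ≠ c) (had : a ≠ d) (hbd : b ≠ d) (hbe : b ≠ e) (hce : c ≠ e) : False := by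
  refine h5 a (.cons hab (.cons hbc (.cons hcd (.cons hde (.cons hea .nil))))) ?_ rfl
  have := hab.ne
  have := hbc.ne
  have := hcd.ne
  have := hde.ne
  have := hea.ne
  rw [Walk.cons_isCycle_iff]
  refine ⟨?_, ?_⟩
  · rw [Walk.isPath_def]
    simp
    grind
  · simp
    grind

/-- A permutation of the darts that rotates the darts at each vertex in a single cycle. -/
structure RotationSystem (G : SimpleGraph V) where
  rot : Equiv.Perm G.Dart
  fst_rot : ∀ d, (rot d).fst = d.fst
  sameCycle : ∀ d d' : G.Dart, d.fst = d'.fst → rot.SameCycle d d'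

namespace RotationSystem

/-- The face permutation of a rotation system. -/
def face (R : G.RotationSystem) : Equiv.Perm G.Dart :=
  -- If `rot` is counterclockwise, turning clockwise from the reversed dart keeps the face on the
  -- left.
  (Dart.symm_involutive (G := G)).toPerm.trans R.rot.symm

variable (R : G.RotationSystem)

theorem rot_face (d : G.Dart) : R.rot (R.face d) = d.symm := by
  simp [face]

theorem face_eq_of_rot_eq {d e : G.Dart} (h : R.rot e = d.symm) : R.face d = e :=
  R.rot.injective (by rw [R.rot_face, h])

theorem fst_face (d : G.Dart) : (R.face d).fst = d.snd := by
  rw [← R.fst_rot, R.rot_face]; rfl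

theorem face_symm_rot (d : G.Dart) : R.face (R.rot d).symm = d :=
  R.face_eq_of_rot_eq (by simp)

/-- The length of the face to the left of a dart. -/
noncomputable def len (d : G.Dart) : ℕ := minimalPeriod R.face d

variable [Finite G.Dart]

theorem len_face (d : G.Dart) : R.len (R.face d) = R.len d :=
  minimalPeriod_apply (R.face.injective.mem_periodicPts d)

/-- The corner between `d` and `rot d` lies to the left of `d` and to the right of `rot d`. Thus
`len d` also measures the face at that corner. -/
theorem len_symm_rot (d : G.Dart) : R.len (R.rot d).symm = R.len d := by
  conv_rhs => rw [← R.face_symm_rot d]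
  rw [len_face]

theorem len_pos (d : G.Dart) : 0 < R.len d :=
  minimalPeriod_pos_of_mem_periodicPts (R.face.injective.mem_periodicPts d)

omit [Finite G.Dart] in
theorem iterate_len (d : G.Dart) : R.face^[R.len d] d = d := iterate_minimalPeriod

omit [Finite G.Dart] in
theorem snd_ne_of_ne {d e : G.Dart} (hf : d.fst = e.fst) (h : d ≠ e) : d.snd ≠ e.snd :=
  fun hs => h (Dart.ext _ _ (Prod.ext hf hs))

/-- Every vertex that carries a dart has degree at least four. -/
def MinFour : Prop := ∀ d, R.rot d ≠ d ∧ R.rot (R.rot d) ≠ d ∧ R.rot (R.rot (R.rot d)) ≠ d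

variable {R} (h4 : R.MinFour)
include h4

omit [Finite G.Dart] in
-- A facial walk backtracks only at a vertex of degree one.
theorem MinFour.snd_face_ne (d : G.Dart) : (R.face d).snd ≠ d.fst := by
  intro h
  have : R.face d = d.symm := Dart.ext _ _ (Prod.ext (R.fst_face d) h)
  have h2 := R.rot_face d
  rw [this] at h2
  exact (h4 _).1 h2

theorem MinFour.three_le_len (d : G.Dart) : 3 ≤ R.len d := by
  by_contra! hlt
  have hp := R.len_pos d
  have hit := R.iterate_len d
  have hc : R.len d = 1 ∨ R.len d = 2 := by omega
  rcases hc with hc | hc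
  · rw [hc] at hit
    have := R.fst_face d
    simp only [iterate_one] at hit
    rw [hit] at this
    exact d.adj.ne this
  · rw [hc] at hit
    have h2 : R.face (R.face d) = d := hit
    have := R.fst_face (R.face d)
    rw [h2] at this
    exact h4.snd_face_ne d this.symm

omit [Finite G.Dart] in
-- In a closed walk of length five any two positions are one or two steps apart; adjacency separates
-- the former and the absence of backtracking the latter, so the walk would be a 5-cycle.
theorem MinFour.len_ne_five (h5 : G.NoFiveCycle) (d : G.Dart) : R.len d ≠ 5 := by
  intro hc
  have hit := R.iterate_len d
  rw [hc] at hit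
  have hit : R.face (R.face (R.face (R.face (R.face d)))) = d := hit
  set d1 := R.face d with e1
  set d2 := R.face d1 with e2
  set d3 := R.face d2 with e3
  set d4 := R.face d3 with e4
  have f1 : d1.fst = d.snd := R.fst_face d
  have f2 : d2.fst = d1.snd := R.fst_face d1
  have f3 : d3.fst = d2.snd := R.fst_face d2
  have f4 : d4.fst = d3.snd := R.fst_face d3
  have f5 : d.fst = d4.snd := by rw [← R.fst_face d4, hit]
  have n0 := h4.snd_face_ne d
  have n1 := h4.snd_face_ne d1
  have n2 := h4.snd_face_ne d2
  have n3 := h4.snd_face_ne d3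
  have n4 := h4.snd_face_ne d4
  rw [hit] at n4
  rw [← e1, ← f2] at n0
  rw [← e2, ← f3] at n1
  rw [← e3, ← f4] at n2
  rw [← e4, ← f5] at n3
  rw [← f1] at n4
  have a0 := d.adj
  have a1 := d1.adj
  have a2 := d2.adj
  have a3 := d3.adj
  have a4 := d4.adj
  rw [← f1] at a0
  rw [← f2] at a1
  rw [← f3] at a2
  rw [← f4] at a3
  rw [← f5] at a4
  exact h5.false_of_adj a0 a1 a2 a3 a4 n0.symm n3 n1.symm n4 n2.symm

omit h4 [Finite G.Dart] in
theorem face_face_of_len_eq_three {d : G.Dart} (h : R.len d = 3) :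
    R.rot d = (R.face (R.face d)).symm := by
  have hit := R.iterate_len d
  rw [h] at hit
  have hit : R.face (R.face (R.face d)) = d := hit
  rw [← R.rot_face (R.face (R.face d)), hit]

omit h4 [Finite G.Dart] in
theorem adj_of_len_eq_three {d : G.Dart} (h : R.len d = 3) : G.Adj d.snd (R.rot d).snd := by
  have h1 := (R.face d).adj
  rw [R.fst_face, ← R.fst_face (R.face d)] at h1
  rw [face_face_of_len_eq_three h]
  exact h1

omit [Finite G.Dart] in
-- Three consecutive triangles form a fan whose boundary is a 5-cycle through the centre; degree at
-- least four keeps its four outer vertices distinct.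
theorem MinFour.not_three_triangles (h5 : G.NoFiveCycle) {d : G.Dart} (h0 : R.len d = 3)
    (h1 : R.len (R.rot d) = 3) : R.len (R.rot (R.rot d)) ≠ 3 := by
  intro h2
  have f1 := R.fst_rot d
  have f2 := R.fst_rot (R.rot d)
  have f3 := R.fst_rot (R.rot (R.rot d))
  have a0 := adj_of_len_eq_three h0
  have a1 := adj_of_len_eq_three h1
  have a2 := adj_of_len_eq_three h2
  have b0 := d.adj
  have b1 := (R.rot d).adj
  have b2 := (R.rot (R.rot d)).adj
  have b3 := (R.rot (R.rot (R.rot d))).adj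
  obtain ⟨-, q2, q3⟩ := h4 d
  obtain ⟨-, q2', -⟩ := h4 (R.rot d)
  have n02 := snd_ne_of_ne (by rw [f2, f1]) q2
  have n03 := snd_ne_of_ne (by rw [f3, f2, f1]) q3
  have n13 := snd_ne_of_ne (by rw [f3, f2]) q2'
  rw [f3, f2, f1] at b3
  rw [f2, f1] at b2
  rw [f1] at b1
  exact h5.false_of_adj b0 a0 a1 a2 b3.symm b1.ne b2.ne n02.symm n03.symm n13.symm

omit [Finite G.Dart] in
-- A triangle and a quadrilateral glued along `d` leave a closed walk of length five. If the apex of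
-- the triangle were a further vertex of the quadrilateral, two darts at an end of `d` would
-- coincide and the degree there would be too small.
theorem MinFour.len_symm_ne_four (h5 : G.NoFiveCycle) {d : G.Dart} (h : R.len d = 3) :
    R.len d.symm ≠ 4 := by
  intro hc
  have hit := R.iterate_len d.symm
  rw [hc] at hit
  have hit : R.face (R.face (R.face (R.face d.symm))) = d.symm := hit
  have hd3 : R.rot d.symm = (R.face (R.face (R.face d.symm))).symm := by
    rw [← R.rot_face (R.face (R.face (R.face d.symm))), hit]
  have hd1 : R.rot (R.face d.symm) = d := by rw [R.rot_face, Dart.symm_symm]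
  have hd2 : R.rot (R.face d) = d.symm := R.rot_face d
  have hz : (R.rot d).snd = (R.face d).snd := by
    rw [face_face_of_len_eq_three h, ← R.fst_face (R.face d)]; rfl
  set e1 := R.face d.symm with he1
  set e2 := R.face e1 with he2
  set e3 := R.face e2 with he3
  have f1 : e1.fst = d.fst := R.fst_face d.symm
  have f2 : e2.fst = e1.snd := R.fst_face e1
  have f3 : e3.fst = e2.snd := R.fst_face e2
  have f4 : e3.snd = d.snd := by rw [← R.fst_face e3, hit]; rfl
  have fr : (R.rot d).fst = d.fst := R.fst_rot d
  have ff : (R.face d).fst = d.snd := R.fst_face d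
  have a1 := (R.rot d).adj
  have a2 := (R.face d).adj
  have a3 := e3.adj
  have a4 := e2.adj
  have a5 := e1.adj
  -- the neighbours of the two ends of `d` are distinct
  have n1 : (R.rot d).snd ≠ e1.snd := by
    refine snd_ne_of_ne (by rw [fr, f1]) ?_
    have := (h4 e1).2.1
    rwa [hd1] at this
  have n2 : d.snd ≠ e1.snd := by
    refine snd_ne_of_ne f1.symm ?_
    have := (h4 e1).1
    rwa [hd1] at this
  have n3 : (R.rot d.symm).snd ≠ (R.face d).snd := by
    refine snd_ne_of_ne (by rw [R.fst_rot, ff]; rfl) ?_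
    have := (h4 (R.face d)).2.1
    rwa [hd2] at this
  have n4 : (R.rot d.symm).snd ≠ d.symm.snd :=
    snd_ne_of_ne (R.fst_rot _) (h4 _).1
  have hb : (R.rot d.symm).snd = e3.fst := by rw [hd3]; rfl
  have hs : d.symm.snd = d.fst := rfl
  rw [hb] at n3 n4
  rw [hs] at n4
  rw [fr] at a1
  rw [ff, ← hz] at a2
  rw [f4] at a3
  rw [f2, ← f3] at a4
  rw [f1] at a5
  rw [← hz] at n3
  exact h5.false_of_adj a1 a2.symm a3.symm a4.symm a5.symm d.adj.ne n4.symm n3.symm n1 n2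

/-- The face on the other side of a triangle is a triangle or has length at least six. -/
theorem MinFour.six_le_len_symm (h5 : G.NoFiveCycle) {d : G.Dart} (h : R.len d = 3)
    (h' : R.len d.symm ≠ 3) : 6 ≤ R.len d.symm := by
  have := h4.three_le_len d.symm
  have := h4.len_symm_ne_four h5 h
  have := h4.len_ne_five h5 d.symm
  omega

end RotationSystem

end SimpleGraph

/-! ### Discharging -/

namespace SimpleGraph.RotationSystem

open Function

variable {V : Type*} {G : SimpleGraph V} [Finite G.Dart] (R : G.RotationSystem)

/-- The valency of the tail of a dart. -/
noncomputable def val (d : G.Dart) : ℕ := minimalPeriod R.rot d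

theorem val_rot (d : G.Dart) : R.val (R.rot d) = R.val d :=
  minimalPeriod_apply (R.rot.injective.mem_periodicPts d)

omit [Finite G.Dart] in
theorem iterate_val (d : G.Dart) : R.rot^[R.val d] d = d := iterate_minimalPeriod

/-- The charge of a face, spread over its darts. -/
noncomputable def faceCharge (d : G.Dart) : ℚ := 1 - 4 / R.len d

/-- The charge of the two sides of an edge, halved. -/
noncomputable def edgeCharge (d : G.Dart) : ℚ := (R.faceCharge d + R.faceCharge d.symm) / 2

variable {R} (h4 : R.MinFour)
include h4

theorem MinFour.four_le_val (d : G.Dart) : 4 ≤ R.val d := by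
  by_contra! hlt
  have hp : 0 < R.val d :=
    minimalPeriod_pos_of_mem_periodicPts (R.rot.injective.mem_periodicPts d)
  have hit := R.iterate_val d
  obtain ⟨h1, h2, h3⟩ := h4 d
  interval_cases R.val d
  · exact h1 hit
  · exact h2 hit
  · exact h3 hit

theorem MinFour.faceCharge_ge (d : G.Dart) : -1 / 3 ≤ R.faceCharge d := by
  have h : (3 : ℚ) ≤ R.len d := by exact_mod_cast h4.three_le_len d
  have : 4 / (R.len d : ℚ) ≤ 4 / 3 := by gcongr
  unfold faceCharge
  linarith

omit h4 [Finite G.Dart] in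
theorem faceCharge_of_six_le {d : G.Dart} (h : 6 ≤ R.len d) : 1 / 3 ≤ R.faceCharge d := by
  have h : (6 : ℚ) ≤ R.len d := by exact_mod_cast h
  have : 4 / (R.len d : ℚ) ≤ 4 / 6 := by gcongr
  unfold faceCharge
  linarith

theorem MinFour.faceCharge_nonneg {d : G.Dart} (h : R.len d ≠ 3) : 0 ≤ R.faceCharge d := by
  have h3 := h4.three_le_len d
  have h : (4 : ℚ) ≤ R.len d := by exact_mod_cast (by omega : 4 ≤ R.len d)
  have : 4 / (R.len d : ℚ) ≤ 4 / 4 := by gcongr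
  unfold faceCharge
  linarith

variable (h5 : G.NoFiveCycle)
include h5

/-- A single triangular side costs 1/3, which the face of length at least six on the other side
repays. -/
theorem MinFour.edgeCharge_nonneg {d : G.Dart} (h : ¬ (R.len d = 3 ∧ R.len d.symm = 3)) :
    0 ≤ R.edgeCharge d := by
  unfold edgeCharge
  have h1 := h4.faceCharge_ge d
  have h2 := h4.faceCharge_ge d.symm
  by_cases hd : R.len d = 3
  · have hs : R.len d.symm ≠ 3 := fun hs => h ⟨hd, hs⟩
    have := faceCharge_of_six_le (h4.six_le_len_symm h5 hd hs)
    linarith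
  · have h3 := h4.faceCharge_nonneg hd
    by_cases hs : R.len d.symm = 3
    · have := faceCharge_of_six_le (h4.six_le_len_symm h5 (d := d.symm) hs (by simpa using hd))
      simp only [Dart.symm_symm] at this
      linarith
    · have := h4.faceCharge_nonneg hs
      linarith

omit h5 in
theorem MinFour.edgeCharge_ge (d : G.Dart) : -1 / 3 ≤ R.edgeCharge d := by
  unfold edgeCharge
  have h1 := h4.faceCharge_ge d
  have h2 := h4.faceCharge_ge d.symm
  linarith

/-- At a vertex, no two consecutive edges lie on two triangular faces each. -/
theorem MinFour.edgeCharge_add_rot (d : G.Dart) :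
    -1 / 3 ≤ R.edgeCharge d + R.edgeCharge (R.rot d) := by
  have b1 := h4.edgeCharge_ge d
  have b2 := h4.edgeCharge_ge (R.rot d)
  by_cases h : R.len d = 3 ∧ R.len d.symm = 3
  · have : ¬ (R.len (R.rot d) = 3 ∧ R.len (R.rot d).symm = 3) := by
      rintro ⟨h1, -⟩
      -- With `d = rot e`, the right side of `d` is the corner at `e`, so the corners at `e`, `rot
      -- e` and `rot (rot e)` would all be triangular.
      obtain ⟨e, rfl⟩ := R.rot.surjective d
      rw [len_symm_rot] at h
      exact h4.not_three_triangles h5 h.2 h.1 h1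
    have := h4.edgeCharge_nonneg h5 this
    linarith
  · have := h4.edgeCharge_nonneg h5 h
    linarith

/-- At a vertex of degree four the two corners not touching `d` are both adjacent to triangles
without being triangles themselves. They have length at least six and are the two sides of the
opposite edge. -/
theorem MinFour.edgeCharge_opposite {d : G.Dart} (hd : R.val d = 4)
    (h : R.len d = 3 ∧ R.len d.symm = 3) : 1 / 3 ≤ R.edgeCharge (R.rot (R.rot d)) := by
  have hit := R.iterate_val d
  rw [hd] at hit
  have hit : R.rot (R.rot (R.rot (R.rot d))) = d := hit
  obtain ⟨h1, h2⟩ := h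
  -- the corners around the vertex
  have c1 : R.len (R.rot (R.rot (R.rot d))) = 3 := by
    rw [← R.len_symm_rot, hit, h2]
  have n1 : R.len (R.rot d) ≠ 3 := by
    have := h4.not_three_triangles h5 c1 (by rwa [hit])
    rwa [hit] at this
  have n2 : R.len (R.rot (R.rot d)) ≠ 3 := by
    intro h
    exact h4.not_three_triangles h5 h c1 (by rwa [hit])
  have s1 : 6 ≤ R.len (R.rot d) := by
    have h0 : R.len (R.rot d).symm = 3 := by rw [len_symm_rot, h1]
    have := h4.six_le_len_symm h5 h0 (by simpa using n1)
    simpa using this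
  have s2 : 6 ≤ R.len (R.rot (R.rot d)) := by
    have := h4.six_le_len_symm h5 c1 (by rwa [len_symm_rot])
    rwa [len_symm_rot] at this
  have g1 := faceCharge_of_six_le s2
  have g2 : 1 / 3 ≤ R.faceCharge (R.rot (R.rot d)).symm :=
    faceCharge_of_six_le (by rwa [len_symm_rot])
  unfold edgeCharge
  linarith

theorem MinFour.edgeCharge_add_opposite {d : G.Dart} (hd : R.val d = 4) :
    0 ≤ R.edgeCharge d + R.edgeCharge (R.rot (R.rot d)) := by
  have b1 := h4.edgeCharge_ge d
  have b2 := h4.edgeCharge_ge (R.rot (R.rot d))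
  by_cases h : R.len d = 3 ∧ R.len d.symm = 3
  · have := h4.edgeCharge_opposite h5 hd h
    linarith
  · have b3 := h4.edgeCharge_nonneg h5 h
    by_cases h' : R.len (R.rot (R.rot d)) = 3 ∧ R.len (R.rot (R.rot d)).symm = 3
    · have := h4.edgeCharge_opposite h5 (by rw [val_rot, val_rot, hd]) h'
      have hit := R.iterate_val d
      rw [hd] at hit
      have hit : R.rot (R.rot (R.rot (R.rot d))) = d := hit
      rw [hit] at this
      linarith
    · have := h4.edgeCharge_nonneg h5 h'
      linarith

/-- The discharging argument: the total charge of vertices and faces is nonnegative. -/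
theorem MinFour.sum_charge_nonneg [Fintype G.Dart] :
    0 ≤ ∑ d, (1 - 4 / (R.val d : ℚ)) + ∑ d, R.faceCharge d := by
  classical
  -- A vertex of degree four has no charge to give, so there an edge is balanced against the
  -- opposite one; elsewhere against the next one.
  let τ : G.Dart → G.Dart := fun d => if R.val d = 4 then R.rot (R.rot d) else R.rot d
  have hτ : Bijective τ := by
    refine Finite.injective_iff_bijective.mp fun d e h => ?_
    have hv : ∀ d, R.val (τ d) = R.val d := by
      intro d
      simp only [τ]
      split_ifs <;> simp [val_rot]
    have hde : R.val d = R.val e := by rw [← hv d, ← hv e, h]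
    simp only [τ, hde] at h
    split_ifs at h
    · exact R.rot.injective (R.rot.injective h)
    · exact R.rot.injective h
  have s1 : ∑ d, R.edgeCharge (τ d) = ∑ d, R.edgeCharge d := hτ.sum_comp R.edgeCharge
  have s2 : ∑ d : G.Dart, R.faceCharge d.symm = ∑ d, R.faceCharge d :=
    (Dart.symm_involutive (G := G)).bijective.sum_comp R.faceCharge
  have s3 : ∑ d, R.edgeCharge d = ∑ d, R.faceCharge d := by
    simp only [edgeCharge]
    rw [← Finset.sum_div, Finset.sum_add_distrib, s2]
    ring
  have key : ∀ d, 0 ≤ (1 - 4 / (R.val d : ℚ)) + (R.edgeCharge d + R.edgeCharge (τ d)) / 2 := by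
    intro d
    have hv := h4.four_le_val d
    by_cases hd : R.val d = 4
    · have := h4.edgeCharge_add_opposite h5 hd
      simp only [τ, hd, if_true]
      push_cast
      linarith
    · have := h4.edgeCharge_add_rot h5 d
      simp only [τ, hd, if_false]
      -- The vertex supplies at least 1/5 per dart, and half of the deficit 1/3 is only 1/6.
      have hv5 : (5 : ℚ) ≤ R.val d := by exact_mod_cast (by omega : 5 ≤ R.val d)
      have : 4 / (R.val d : ℚ) ≤ 4 / 5 := by gcongr
      linarith
  have total := Finset.sum_nonneg fun d (_ : d ∈ Finset.univ) => key d
  rw [Finset.sum_add_distrib, ← Finset.sum_div, Finset.sum_add_distrib, s1, s3] at total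
  linarith

omit h4 h5

theorem val_eq_degree [Fintype V] [DecidableRel G.Adj] (d : G.Dart) :
    R.val d = G.degree d.fst := by
  classical
  rw [← G.dart_fst_fiber_card_eq_degree d.fst, val, ← R.rot.card_sameCycle_eq_minimalPeriod]
  congr 1
  ext e
  simp only [Finset.mem_filter, Finset.mem_univ, true_and]
  constructor
  · intro h
    obtain ⟨i, rfl⟩ := h.exists_nat_pow_eq
    induction i with
    | zero => rfl
    | succ i ih =>
      rw [pow_succ', Equiv.Perm.mul_apply, R.fst_rot]
      exact ih ⟨i, by simp⟩
  · intro h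
    exact R.sameCycle d e h.symm

theorem sum_one_div_val [Fintype V] [DecidableRel G.Adj] :
    ∑ d, (1 / (R.val d : ℚ)) = Nat.card {v // 0 < G.degree v} := by
  classical
  rw [← Finset.sum_fiberwise (s := Finset.univ) (g := fun d : G.Dart => d.fst)]
  have h1 : ∀ v, ∑ d : G.Dart with d.fst = v, (1 / (R.val d : ℚ)) =
      if 0 < G.degree v then 1 else 0 := by
    intro v
    have : ∀ d ∈ Finset.univ.filter (fun d : G.Dart => d.fst = v),
        (1 / (R.val d : ℚ)) = 1 / (G.degree v : ℚ) := by
      intro d hd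
      rw [val_eq_degree, (Finset.mem_filter.mp hd).2]
    rw [Finset.sum_congr rfl this, Finset.sum_const, G.dart_fst_fiber_card_eq_degree]
    split_ifs with hv
    · have : (G.degree v : ℚ) ≠ 0 := by positivity
      simp [this]
    · have : G.degree v = 0 := by omega
      simp [this]
  rw [Finset.sum_congr rfl fun v _ => h1 v, Nat.card_eq_fintype_card, Fintype.card_subtype,
    Finset.card_filter]
  push_cast
  rfl

/-- In a rotation system without five-cycles that satisfies Euler's inequality, some vertex has
degree one, two or three. -/
theorem exists_degree_le_three [Fintype V] [DecidableRel G.Adj] (R : G.RotationSystem)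
    (h5 : G.NoFiveCycle)
    (euler : G.edgeFinset.card + 1 ≤ Nat.card {v // 0 < G.degree v} +
      Nat.card (Quotient (Equiv.Perm.SameCycle.setoid R.face))) :
    ∃ v, 0 < G.degree v ∧ G.degree v ≤ 3 := by
  classical
  by_contra! hdeg
  have hval : ∀ d, 4 ≤ R.val d := by
    intro d
    rw [val_eq_degree]
    exact hdeg _ ((G.degree_pos_iff_exists_adj _).mpr ⟨_, d.adj⟩)
  have h4 : R.MinFour := fun d =>
    ⟨not_isPeriodicPt_of_pos_of_lt_minimalPeriod (n := 1) one_ne_zero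
        (lt_of_lt_of_le (by norm_num) (hval d)),
      not_isPeriodicPt_of_pos_of_lt_minimalPeriod (n := 2) two_ne_zero
        (lt_of_lt_of_le (by norm_num) (hval d)),
      not_isPeriodicPt_of_pos_of_lt_minimalPeriod (n := 3) three_ne_zero
        (lt_of_lt_of_le (by norm_num) (hval d))⟩
  have total := h4.sum_charge_nonneg h5
  have hF : ∑ d, (1 / (R.len d : ℚ)) = _ := R.face.sum_one_div_minimalPeriod
  have hV := sum_one_div_val (R := R)
  have hE : (Fintype.card G.Dart : ℚ) = 2 * G.edgeFinset.card := by
    exact_mod_cast G.dart_card_eq_twice_card_edges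
  have e1 : ∑ d, (1 - 4 / (R.val d : ℚ)) =
      Fintype.card G.Dart - 4 * ∑ d, (1 / (R.val d : ℚ)) := by
    rw [Finset.sum_sub_distrib, Finset.mul_sum]
    simp [div_eq_mul_inv]
  have e2 : ∑ d, R.faceCharge d = Fintype.card G.Dart - 4 * ∑ d, (1 / (R.len d : ℚ)) := by
    simp only [faceCharge]
    rw [Finset.sum_sub_distrib, Finset.mul_sum]
    simp [div_eq_mul_inv]
  -- The total charge is 4(E - V - F), at most -4 by Euler's inequality.
  rw [e1, e2, hF, hV, hE] at total
  have euler' : (G.edgeFinset.card : ℚ) + 1 ≤ Nat.card {v // 0 < G.degree v} +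
      Nat.card (Quotient (Equiv.Perm.SameCycle.setoid R.face)) := by exact_mod_cast euler
  linarith

end SimpleGraph.RotationSystem

/-! ### Angles of view and winding numbers of segment systems -/

open Filter Topology

/-- A finite family of oriented non-degenerate segments in the complex plane that meet at most in
common ends. -/
structure SegmentSystem (S : Type*) where
  a : S → ℂ
  b : S → ℂ
  ne : ∀ s, a s ≠ b s
  inter : ∀ s t, s ≠ t → ∀ x, x ∈ segment ℝ (a s) (b s) → x ∈ segment ℝ (a t) (b t) →
    (x = a s ∨ x = b s) ∧ (x = a t ∨ x = b t)

namespace SegmentSystem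

open Complex

/-- The oriented angle under which the segment from `a` to `b` is seen from `x`. -/
noncomputable def viewAngle (a b x : ℂ) : ℝ := arg ((b - x) / (a - x))

theorem mem_segment_of_viewAngle_eq_pi {a b x : ℂ} (h : ¬ (b - x) / (a - x) ∈ slitPlane) :
    x ∈ segment ℝ a b := by
  by_cases hax : a - x = 0
  · rw [sub_eq_zero] at hax
    rw [← hax]
    exact left_mem_segment ℝ a b
  · rw [mem_slitPlane_iff, not_or, not_lt, ne_eq, not_not] at h
    obtain ⟨hre, him⟩ := h
    set w := (b - x) / (a - x) with hw
    have hw' : w = ((w.re : ℝ) : ℂ) := by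
      apply Complex.ext <;> simp [him]
    have hb : b - x = w.re * (a - x) := by
      rw [← hw', hw]; field_simp
    have hpos : 0 < 1 - w.re := by linarith
    refine ⟨-w.re / (1 - w.re), 1 / (1 - w.re), by apply div_nonneg <;> linarith,
      by positivity, by field_simp; ring, ?_⟩
    have hc : ((1 - w.re : ℝ) : ℂ) ≠ 0 := by exact_mod_cast hpos.ne'
    have hb2 : b = x + w.re * (a - x) := by rw [← hb]; ring
    simp only [real_smul, hb2]
    push_cast at hc ⊢
    field_simp
    ring

theorem continuousAt_viewAngle {a b x : ℂ} (h : x ∉ segment ℝ a b) :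
    ContinuousAt (viewAngle a b) x := by
  have hs : (b - x) / (a - x) ∈ slitPlane := by
    by_contra hc
    exact h (mem_segment_of_viewAngle_eq_pi hc)
  have hax : a - x ≠ 0 := by
    intro h0
    rw [h0] at hs
    simp at hs
  unfold viewAngle
  refine (continuousAt_arg hs).comp (f := fun x => (b - x) / (a - x)) ?_
  exact ContinuousAt.div (by fun_prop) (by fun_prop) hax

theorem viewAngle_of_mem_openSegment {a b x : ℂ} (hab : a ≠ b) (h : x ∈ openSegment ℝ a b) :
    viewAngle a b x = Real.pi := by
  obtain ⟨p, q, hp, hq, hpq, rfl⟩ := h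
  have hq' : (q : ℂ) ≠ 0 := by exact_mod_cast hq.ne'
  have hp' : (p : ℂ) = 1 - q := by rw [eq_sub_of_add_eq hpq]; push_cast; ring
  have hab' : b - a ≠ 0 := sub_ne_zero.mpr hab.symm
  have : (b - (p • a + q • b)) / (a - (p • a + q • b)) = ((-(p / q) : ℝ) : ℂ) := by
    simp only [real_smul]
    have h1 : a - (p * a + q * b) = - (q * (b - a)) := by rw [hp']; ring
    have h2 : b - (p * a + q * b) = p * (b - a) := by rw [hp']; ring
    rw [h1, h2]
    push_cast
    field_simp
  rw [viewAngle, this]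
  exact arg_ofReal_of_neg (by have := div_pos hp hq; linarith)

theorem viewAngle_coe {a b x : ℂ} (ha : x ≠ a) (hb : x ≠ b) :
    (viewAngle a b x : Real.Angle) = arg (b - x) - arg (a - x) :=
  arg_div_coe_angle (sub_ne_zero.mpr hb.symm) (sub_ne_zero.mpr ha.symm)

/-- The limits of the angle of view of a segment, as a point on a small circle about one end
approaches the segment from either side. -/
theorem tendsto_viewAngle_circle (c : ℂ) {r ρ : ℝ} (hr : 0 < r) (hρ : r < ρ) (θ : ℝ) :
    (Tendsto (fun t : ℝ => viewAngle c (c + ρ * exp (θ * I)) (c + r * exp (t * I)))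
      (𝓝[>] θ) (𝓝 Real.pi) ∧
    Tendsto (fun t : ℝ => viewAngle c (c + ρ * exp (θ * I)) (c + r * exp (t * I)))
      (𝓝[<] θ) (𝓝 (-Real.pi))) ∧
    (Tendsto (fun t : ℝ => viewAngle (c + ρ * exp (θ * I)) c (c + r * exp (t * I)))
      (𝓝[>] θ) (𝓝 (-Real.pi)) ∧
    Tendsto (fun t : ℝ => viewAngle (c + ρ * exp (θ * I)) c (c + r * exp (t * I)))
      (𝓝[<] θ) (𝓝 Real.pi)) := by
  have hr' : (r : ℂ) ≠ 0 := by exact_mod_cast hr.ne'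
  -- The quotient of the two directions of view: negative real at θ, with imaginary part of the sign
  -- of t - θ nearby, so its argument jumps between π and -π.
  let w : ℝ → ℂ := fun t => 1 - (ρ / r : ℝ) * exp ((θ - t : ℝ) * I)
  have hw : ∀ t : ℝ, (c + ρ * exp (θ * I) - (c + r * exp (t * I))) / (c - (c + r * exp (t * I))) =
      w t := by
    intro t
    have he : exp ((θ - t : ℝ) * I) = exp (θ * I) / exp (t * I) := by
      rw [← exp_sub]; congr 1; push_cast; ring
    have := exp_ne_zero (t * I)
    simp only [w, he]
    push_cast
    field_simp
    ring
  have hwinv : ∀ t : ℝ, (c - (c + r * exp (t * I))) / (c + ρ * exp (θ * I) - (c + r * exp (t * I))) =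
      (w t)⁻¹ := by
    intro t
    rw [← hw t, inv_div]
  have him : ∀ t, (w t).im = (ρ / r) * Real.sin (t - θ) := by
    intro t
    have hs : Real.sin (θ - t) = -Real.sin (t - θ) := by rw [← Real.sin_neg, neg_sub]
    simp only [w, sub_im, one_im, im_ofReal_mul, exp_ofReal_mul_I_im, hs]
    ring
  have hcont : Continuous w := by fun_prop
  have hw0 : w θ = ((1 - ρ / r : ℝ) : ℂ) := by simp [w]
  have hneg : 1 - ρ / r < 0 := by
    have : 1 < ρ / r := by rw [one_lt_div hr]; exact hρ
    linarith
  have hre0 : (w θ).re < 0 := by rw [hw0, ofReal_re]; exact hneg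
  have him0 : (w θ).im = 0 := by rw [hw0, ofReal_im]
  have hquot : 0 < ρ / r := div_pos (hr.trans hρ) hr
  have hgt : ∀ᶠ t in 𝓝[>] θ, 0 < (w t).im := by
    have : Set.Ioo θ (θ + Real.pi) ∈ 𝓝[>] θ := Ioo_mem_nhdsGT (by linarith [Real.pi_pos])
    filter_upwards [this] with t ht
    rw [him]
    exact mul_pos hquot (Real.sin_pos_of_pos_of_lt_pi (by linarith [ht.1]) (by linarith [ht.2]))
  have hlt : ∀ᶠ t in 𝓝[<] θ, (w t).im < 0 := by
    have : Set.Ioo (θ - Real.pi) θ ∈ 𝓝[<] θ := Ioo_mem_nhdsLT (by linarith [Real.pi_pos])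
    filter_upwards [this] with t ht
    rw [him]
    exact mul_neg_of_pos_of_neg hquot
      (Real.sin_neg_of_neg_of_neg_pi_lt (by linarith [ht.2]) (by linarith [ht.1]))
  have tgt : Tendsto (fun t => arg (w t)) (𝓝[>] θ) (𝓝 Real.pi) :=
    (tendsto_arg_nhdsWithin_im_nonneg_of_re_neg_of_im_zero hre0 him0).comp
      (tendsto_nhdsWithin_iff.mpr ⟨(hcont.tendsto θ).mono_left nhdsWithin_le_nhds,
        hgt.mono fun t ht => ht.le⟩)
  have tlt : Tendsto (fun t => arg (w t)) (𝓝[<] θ) (𝓝 (-Real.pi)) :=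
    (tendsto_arg_nhdsWithin_im_neg_of_re_neg_of_im_zero hre0 him0).comp
      (tendsto_nhdsWithin_iff.mpr ⟨(hcont.tendsto θ).mono_left nhdsWithin_le_nhds, hlt⟩)
  have hinv : ∀ t, (w t).im ≠ 0 → arg (w t)⁻¹ = - arg (w t) := by
    intro t ht
    rw [arg_inv, if_neg]
    intro h
    exact ht (arg_eq_pi_iff.mp h).2
  simp only [viewAngle, hw, hwinv]
  refine ⟨⟨tgt, tlt⟩, ?_, ?_⟩
  · refine tgt.neg.congr' ?_
    filter_upwards [hgt] with t ht
    rw [hinv t ht.ne']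
  · have := tlt.neg
    rw [neg_neg] at this
    refine this.congr' ?_
    filter_upwards [hlt] with t ht
    rw [hinv t ht.ne]

variable {S : Type*} [Fintype S] (Q : SegmentSystem S)

/-- `z` is a circulation along the segments: every function of the ends sums to zero. -/
def IsCirculation (z : S → ℤ) : Prop :=
  ∀ g : ℂ → Real.Angle, ∑ s, z s • (g (Q.b s) - g (Q.a s)) = 0

/-- The total angle described by the circulation `z` about `x`. -/
noncomputable def winding (z : S → ℤ) (x : ℂ) : ℝ :=
  ∑ s, z s * viewAngle (Q.a s) (Q.b s) x

theorem winding_add (z z' : S → ℤ) (x : ℂ) :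
    Q.winding (z + z') x = Q.winding z x + Q.winding z' x := by
  simp only [winding, ← Finset.sum_add_distrib]
  refine Finset.sum_congr rfl fun s _ => ?_
  simp only [Pi.add_apply, Int.cast_add]
  ring

/-- The real numbers that are multiples of a full turn. -/
def fullTurns : Set ℝ := Set.range fun n : ℤ => (n : ℝ) * (2 * Real.pi)

theorem isDiscrete_fullTurns : IsDiscrete fullTurns := by
  have h : fullTurns = (AddSubgroup.zmultiples (2 * Real.pi) : Set ℝ) := by
    ext x
    simp [fullTurns, AddSubgroup.mem_zmultiples_iff]
  rw [h, isDiscrete_iff_discreteTopology]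
  exact inferInstanceAs (DiscreteTopology (AddSubgroup.zmultiples (2 * Real.pi)))

variable {Q} {z : S → ℤ} 

/-- Modulo full turns the angle of view is a difference of arguments at the two ends, and a
circulation annihilates such differences. The point may lie inside a segment, just not at an end. -/
theorem IsCirculation.winding_mem (hz : Q.IsCirculation z) {x : ℂ}
    (hx : ∀ s, x ≠ Q.a s ∧ x ≠ Q.b s) : Q.winding z x ∈ fullTurns := by
  have h := hz fun p => (arg (p - x) : Real.Angle)
  have h2 : ((Q.winding z x : ℝ) : Real.Angle) = 0 := by
    rw [← h, winding]
    have : ∀ s, z s • ((arg (Q.b s - x) : Real.Angle) - arg (Q.a s - x)) =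
        ((z s * viewAngle (Q.a s) (Q.b s) x : ℝ) : Real.Angle) := by
      intro s
      rw [← viewAngle_coe (hx s).1 (hx s).2, ← Real.Angle.coe_zsmul, zsmul_eq_mul]
    simp only [this]
    exact map_sum Real.Angle.coeHom _ _
  rw [Real.Angle.coe_eq_zero_iff] at h2
  obtain ⟨n, hn⟩ := h2
  exact ⟨n, by rw [← hn, zsmul_eq_mul]⟩

end SegmentSystem

/-! ### Winding numbers on the two sides of a segment -/

namespace SegmentSystem

open Complex

theorem midpoint_mem_openSegment (x y : ℂ) : midpoint ℝ x y ∈ openSegment ℝ x y := by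
  refine ⟨1 / 2, 1 / 2, by norm_num, by norm_num, by norm_num, ?_⟩
  rw [midpoint_eq_smul_add, smul_add]
  norm_num

variable {S : Type*} (Q : SegmentSystem S)

/-- The tail of a segment, traversed forwards (`true`) or backwards (`false`). -/
def base (d : S × Bool) : ℂ := if d.2 then Q.a d.1 else Q.b d.1

/-- The tip of a segment, traversed forwards (`true`) or backwards (`false`). -/
def tip (d : S × Bool) : ℂ := if d.2 then Q.b d.1 else Q.a d.1

theorem base_ne_tip (d : S × Bool) : Q.base d ≠ Q.tip d := by
  obtain ⟨s, _ | _⟩ := d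
  · exact (Q.ne s).symm
  · exact Q.ne s

theorem openSegment_base_tip (d : S × Bool) :
    openSegment ℝ (Q.base d) (Q.tip d) = openSegment ℝ (Q.a d.1) (Q.b d.1) := by
  obtain ⟨s, _ | _⟩ := d
  · exact openSegment_symm ℝ _ _
  · rfl

theorem segment_base_tip (d : S × Bool) :
    segment ℝ (Q.base d) (Q.tip d) = segment ℝ (Q.a d.1) (Q.b d.1) := by
  obtain ⟨s, _ | _⟩ := d
  · exact segment_symm ℝ _ _
  · rfl

theorem notMem_segment_of_mem_openSegment {s t : S} (hst : t ≠ s) {x : ℂ}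
    (hx : x ∈ openSegment ℝ (Q.a s) (Q.b s)) : x ∉ segment ℝ (Q.a t) (Q.b t) := by
  intro ht
  rcases (Q.inter s t hst.symm x (openSegment_subset_segment ℝ _ _ hx) ht).1 with h | h
  · rw [h, left_mem_openSegment_iff] at hx
    exact Q.ne s hx
  · rw [h, right_mem_openSegment_iff] at hx
    exact Q.ne s hx

theorem ne_ends_of_mem_openSegment {s : S} {x : ℂ} (hx : x ∈ openSegment ℝ (Q.a s) (Q.b s))
    (t : S) : x ≠ Q.a t ∧ x ≠ Q.b t := by
  by_cases hst : t = s
  · subst hst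
    constructor
    · rintro rfl
      exact Q.ne t (left_mem_openSegment_iff.mp hx)
    · rintro rfl
      exact Q.ne t (right_mem_openSegment_iff.mp hx)
  · have := Q.notMem_segment_of_mem_openSegment hst hx
    constructor
    · rintro rfl
      exact this (left_mem_segment ℝ _ _)
    · rintro rfl
      exact this (right_mem_segment ℝ _ _)

theorem mem_openSegment_of_lt {d : S × Bool} {ρ θ r : ℝ} (hr : 0 < r) (hrρ : r < ρ)
    (hd : Q.tip d = Q.base d + ρ * exp (θ * I)) :
    Q.base d + r * exp (θ * I) ∈ openSegment ℝ (Q.a d.1) (Q.b d.1) := by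
  have hρ : 0 < ρ := hr.trans hrρ
  have hρ' : (ρ : ℂ) ≠ 0 := by exact_mod_cast hρ.ne'
  rw [← openSegment_base_tip]
  refine ⟨1 - r / ρ, r / ρ, ?_, div_pos hr hρ, by ring, ?_⟩
  · have := (div_lt_one hρ).mpr hrρ
    linarith
  · rw [hd]
    simp only [real_smul]
    push_cast
    field_simp
    ring

/-- Distinct segments with a common end leave it in distinct directions. -/
theorem eq_of_same_direction {d d' : S × Bool} (hb : Q.base d = Q.base d') {ρ ρ' θ : ℝ}
    (hρ : 0 < ρ) (hρ' : 0 < ρ') (hd : Q.tip d = Q.base d + ρ * exp (θ * I))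
    (hd' : Q.tip d' = Q.base d' + ρ' * exp (θ * I)) : d = d' := by
  by_cases hs : d'.1 = d.1
  · obtain ⟨s, o⟩ := d
    obtain ⟨s', o'⟩ := d'
    simp only at hs
    subst hs
    have := Q.ne s'
    cases o <;> cases o' <;> simp_all [base]
  · exfalso
    have hr : 0 < min ρ ρ' / 2 := by positivity
    have h1 := Q.mem_openSegment_of_lt hr (by linarith [min_le_left ρ ρ']) hd
    have h2 := Q.mem_openSegment_of_lt hr (by linarith [min_le_right ρ ρ']) hd'
    rw [← hb] at h2
    exact Q.notMem_segment_of_mem_openSegment hs h1 (openSegment_subset_segment ℝ _ _ h2)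

variable [Fintype S]

/-- The total angle about points just to the left of a segment. -/
noncomputable def leftValue (z : S → ℤ) (d : S × Bool) : ℝ :=
  -- On the segment itself `arg` takes the value π, its limit from the left of the forward
  -- direction; from the other side the limit is -π, hence the correction by a full turn.
  Q.winding z (midpoint ℝ (Q.a d.1) (Q.b d.1)) - if d.2 then 0 else z d.1 * (2 * Real.pi)

/-- The total angle about points just to the right of a segment. -/
noncomputable def rightValue (z : S → ℤ) (d : S × Bool) : ℝ := Q.leftValue z (d.1, !d.2)

theorem leftValue_add (z z' : S → ℤ) (d : S × Bool) :
    Q.leftValue (z + z') d = Q.leftValue z d + Q.leftValue z' d := by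
  simp only [leftValue, winding_add]
  split_ifs
  · ring
  · simp only [Pi.add_apply, Int.cast_add]
    ring

variable {Q} {z : S → ℤ} (hz : Q.IsCirculation z)
include hz

theorem IsCirculation.leftValue_mem (d : S × Bool) : Q.leftValue z d ∈ fullTurns := by
  obtain ⟨n, hn⟩ := hz.winding_mem
    (Q.ne_ends_of_mem_openSegment (midpoint_mem_openSegment _ _))
  rw [leftValue, ← hn]
  split_ifs
  · exact ⟨n, by ring⟩
  · exact ⟨n - z d.1, by push_cast; ring⟩

/-- The segment's own angle is constantly π there and the others vary continuously, so a continuous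
function with discrete values is constant. -/
theorem IsCirculation.winding_openSegment {s : S} {x : ℂ}
    (hx : x ∈ openSegment ℝ (Q.a s) (Q.b s)) :
    Q.winding z x = Q.winding z (midpoint ℝ (Q.a s) (Q.b s)) := by
  refine (convex_openSegment (Q.a s) (Q.b s)).isPreconnected.constant_of_mapsTo
    isDiscrete_fullTurns ?_
    (fun y hy => hz.winding_mem (Q.ne_ends_of_mem_openSegment hy)) hx (midpoint_mem_openSegment _ _)
  unfold winding
  refine continuousOn_finsetSum _ fun t _ => continuousOn_const.mul ?_
  by_cases hst : t = s
  · subst hst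
    exact continuousOn_const.congr fun y hy => viewAngle_of_mem_openSegment (Q.ne t) hy
  · exact fun y hy => (continuousAt_viewAngle
      (Q.notMem_segment_of_mem_openSegment hst hy)).continuousWithinAt

theorem IsCirculation.tendsto_winding {d : S × Bool} {ρ θ r : ℝ} (hr : 0 < r) (hrρ : r < ρ)
    (hd : Q.tip d = Q.base d + ρ * exp (θ * I)) :
    Tendsto (fun t : ℝ => Q.winding z (Q.base d + r * exp (t * I))) (𝓝[>] θ)
      (𝓝 (Q.leftValue z d)) ∧
    Tendsto (fun t : ℝ => Q.winding z (Q.base d + r * exp (t * I))) (𝓝[<] θ)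
      (𝓝 (Q.rightValue z d)) := by
  classical
  have hx := Q.mem_openSegment_of_lt hr hrρ hd
  have hmid := hz.winding_openSegment hx
  let W : ℝ → ℝ := fun t => ∑ s ∈ Finset.univ.erase d.1,
    z s * viewAngle (Q.a s) (Q.b s) (Q.base d + r * exp (t * I))
  have hsplit : ∀ t : ℝ, Q.winding z (Q.base d + r * exp (t * I)) =
      z d.1 * viewAngle (Q.a d.1) (Q.b d.1) (Q.base d + r * exp (t * I)) + W t := fun t =>
    (Finset.add_sum_erase _ _ (Finset.mem_univ d.1)).symm
  have hW : ContinuousAt W θ := by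
    refine tendsto_finsetSum _ fun s hs => tendsto_const_nhds.mul ?_
    have h1 := continuousAt_viewAngle
      (Q.notMem_segment_of_mem_openSegment (Finset.ne_of_mem_erase hs) hx)
    exact ContinuousAt.comp (f := fun t : ℝ => Q.base d + r * exp (t * I)) h1 (by fun_prop)
  have hval : Q.winding z (midpoint ℝ (Q.a d.1) (Q.b d.1)) = z d.1 * Real.pi + W θ := by
    rw [← hmid, hsplit, viewAngle_of_mem_openSegment (Q.ne _) hx]
  have hgt : Tendsto W (𝓝[>] θ) (𝓝 (W θ)) := hW.tendsto.mono_left nhdsWithin_le_nhds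
  have hlt : Tendsto W (𝓝[<] θ) (𝓝 (W θ)) := hW.tendsto.mono_left nhdsWithin_le_nhds
  simp only [hsplit]
  obtain ⟨⟨t1, t2⟩, t3, t4⟩ := tendsto_viewAngle_circle (Q.base d) hr hrρ θ
  rw [← hd] at t1 t2 t3 t4
  obtain ⟨s, _ | _⟩ := d
  · have e1 : Q.leftValue z (s, false) = z s * -Real.pi + W θ := by
      simp only [leftValue, hval]; simp; ring
    have e2 : Q.rightValue z (s, false) = z s * Real.pi + W θ := by
      simp only [rightValue, leftValue, hval]; simp
    rw [e1, e2]
    exact ⟨(tendsto_const_nhds.mul t3).add hgt, (tendsto_const_nhds.mul t4).add hlt⟩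
  · have e1 : Q.leftValue z (s, true) = z s * Real.pi + W θ := by
      simp only [leftValue, hval]; simp
    have e2 : Q.rightValue z (s, true) = z s * -Real.pi + W θ := by
      simp only [rightValue, leftValue, hval]; simp; ring
    rw [e1, e2]
    exact ⟨(tendsto_const_nhds.mul t1).add hgt, (tendsto_const_nhds.mul t2).add hlt⟩

/-- Across an empty sector, the left value of its first side is the right value of its second
side. -/
theorem IsCirculation.leftValue_eq_rightValue {d d' : S × Bool} (hb : Q.base d' = Q.base d)
    {ρ ρ' θ θ' : ℝ} (hρ : 0 < ρ) (hρ' : 0 < ρ') (hθ : θ < θ')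
    (hd : Q.tip d = Q.base d + ρ * exp (θ * I))
    (hd' : Q.tip d' = Q.base d' + ρ' * exp (θ' * I))
    (hempty : ∀ e, Q.base e = Q.base d → ∀ t ∈ Set.Ioo θ θ', ∀ q : ℝ, 0 < q →
      Q.tip e ≠ Q.base e + q * exp (t * I)) :
    Q.leftValue z d = Q.rightValue z d' := by
  set c := Q.base d with hc
  have hev : ∀ᶠ x in 𝓝 c, ∀ s, c ∉ segment ℝ (Q.a s) (Q.b s) → x ∉ segment ℝ (Q.a s) (Q.b s) := by
    rw [eventually_all]
    intro s
    by_cases h : c ∈ segment ℝ (Q.a s) (Q.b s)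
    · exact Eventually.of_forall fun x hx => absurd h hx
    · have hclosed : IsClosed (segment ℝ (Q.a s) (Q.b s)) := by
        rw [segment_eq_image_lineMap]
        exact (isCompact_Icc.image (by fun_prop)).isClosed
      filter_upwards [hclosed.isOpen_compl.mem_nhds h] with x hx _ using hx
  obtain ⟨ε, hε, hball⟩ := Metric.eventually_nhds_iff.mp hev
  -- Small enough that the circle crosses both given segments and meets no segment avoiding `c`.
  set r := min (min ρ ρ') ε / 2 with hrdef
  have hmin : 0 < min (min ρ ρ') ε := by positivity
  have hr : 0 < r := by positivity
  have hrmin : r < min (min ρ ρ') ε := by linarith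
  have hrρ : r < ρ := hrmin.trans_le ((min_le_left _ _).trans (min_le_left _ _))
  have hrρ' : r < ρ' := hrmin.trans_le ((min_le_left _ _).trans (min_le_right _ _))
  have hrε : r < ε := hrmin.trans_le (min_le_right _ _)
  have havoid : ∀ t ∈ Set.Ioo θ θ', ∀ s, c + r * exp (t * I) ∉ segment ℝ (Q.a s) (Q.b s) := by
    intro t ht s hmem
    have hcs : c ∈ segment ℝ (Q.a s) (Q.b s) := by
      by_contra hcs
      refine hball ?_ s hcs hmem
      rw [dist_eq_norm, add_sub_cancel_left, norm_mul, norm_exp_ofReal_mul_I, mul_one, norm_real,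
        Real.norm_of_nonneg hr.le]
      exact hrε
    -- Since `c` is an end of the segment of `d`, any segment through `c` has it as an end.
    have hend : c = Q.a s ∨ c = Q.b s := by
      by_cases hs : d.1 = s
      · subst hs
        obtain ⟨s, _ | _⟩ := d
        · exact Or.inr rfl
        · exact Or.inl rfl
      · refine (Q.inter d.1 s hs c ?_ hcs).2
        rw [hc, ← segment_base_tip]
        exact left_mem_segment ℝ _ _
    obtain ⟨e, he1, heb⟩ : ∃ e : S × Bool, e.1 = s ∧ Q.base e = c := by
      rcases hend with h | h
      · exact ⟨(s, true), rfl, h.symm⟩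
      · exact ⟨(s, false), rfl, h.symm⟩
    rw [← he1, ← segment_base_tip, heb] at hmem
    obtain ⟨p, q, hp, hq, hpq, heq⟩ := hmem
    have hpc : (p : ℂ) = 1 - q := by rw [eq_sub_of_add_eq hpq]; push_cast; ring
    have hrc : (r : ℂ) ≠ 0 := by exact_mod_cast hr.ne'
    have heq' : q * (Q.tip e - c) = r * exp (t * I) := by
      simp only [real_smul, hpc] at heq
      linear_combination heq
    have hq0 : 0 < q := by
      refine lt_of_le_of_ne hq fun h => ?_
      rw [← h] at heq'
      simp [hr.ne', exp_ne_zero] at heq'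
    have hqc : (q : ℂ) ≠ 0 := by exact_mod_cast hq0.ne'
    refine hempty e heb t ht (r / q) (div_pos hr hq0) ?_
    rw [heb]
    push_cast
    field_simp
    linear_combination heq'
  have hconst : ∀ t ∈ Set.Ioo θ θ', ∀ t' ∈ Set.Ioo θ θ',
      Q.winding z (c + r * exp (t * I)) = Q.winding z (c + r * exp (t' * I)) := by
    intro t ht t' ht'
    refine isPreconnected_Ioo.constant_of_mapsTo isDiscrete_fullTurns
      (f := fun t : ℝ => Q.winding z (c + r * exp (t * I))) ?_ ?_ ht ht'
    · unfold winding
      refine continuousOn_finsetSum _ fun s _ => continuousOn_const.mul fun y hy => ?_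
      exact (ContinuousAt.comp (f := fun t : ℝ => c + r * exp (t * I))
        (continuousAt_viewAngle (havoid y hy s)) (by fun_prop)).continuousWithinAt
    · intro y hy
      refine hz.winding_mem fun s => ⟨?_, ?_⟩
      · intro h
        exact havoid y hy s (h ▸ left_mem_segment ℝ _ _)
      · intro h
        exact havoid y hy s (h ▸ right_mem_segment ℝ _ _)
  obtain ⟨m, hm⟩ := exists_between hθ
  have l1 := (hz.tendsto_winding hr hrρ hd).1
  have l2 := (hz.tendsto_winding hr hrρ' hd').2
  rw [← hc] at l1
  rw [hb] at l2
  have k1 : Q.leftValue z d = Q.winding z (c + r * exp (m * I)) := by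
    refine tendsto_nhds_unique l1 (tendsto_const_nhds.congr' ?_)
    filter_upwards [Ioo_mem_nhdsGT hθ] with t ht
    exact hconst m hm t ht
  have k2 : Q.rightValue z d' = Q.winding z (c + r * exp (m * I)) := by
    refine tendsto_nhds_unique l2 (tendsto_const_nhds.congr' ?_)
    filter_upwards [Ioo_mem_nhdsLT hθ] with t ht
    exact hconst m hm t ht
  rw [k1, k2]

end SegmentSystem

/-- A permutation that moves every point to the next one of its fibre, in the cyclic order given by
a real function that is injective on fibres. -/
theorem exists_cyclic_successor {D V : Type*} [Finite D] (p : D → V) (θ : D → ℝ)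
    (hinj : ∀ d e, p d = p e → θ d = θ e → d = e) :
    ∃ σ : Equiv.Perm D, (∀ d, p (σ d) = p d) ∧ (∀ d e, p d = p e → σ.SameCycle d e) ∧
      ∀ d, (θ d < θ (σ d) ∧ ∀ e, p e = p d → θ e ≤ θ d ∨ θ (σ d) ≤ θ e) ∨
        (θ (σ d) ≤ θ d ∧ ∀ e, p e = p d → θ (σ d) ≤ θ e ∧ θ e ≤ θ d) := by
  classical
  have := Fintype.ofFinite D
  have hnext : ∀ d, ∃ m, p m = p d ∧
      ((θ d < θ m ∧ ∀ e, p e = p d → θ e ≤ θ d ∨ θ m ≤ θ e) ∨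
        (θ m ≤ θ d ∧ ∀ e, p e = p d → θ m ≤ θ e ∧ θ e ≤ θ d)) := by
    intro d
    by_cases h : (Finset.univ.filter fun e => p e = p d ∧ θ d < θ e).Nonempty
    · obtain ⟨m, hm, hmin⟩ := Finset.exists_min_image _ θ h
      simp only [Finset.mem_filter, Finset.mem_univ, true_and] at hm hmin
      refine ⟨m, hm.1, Or.inl ⟨hm.2, fun e he => ?_⟩⟩
      by_cases hde : θ d < θ e
      · exact Or.inr (hmin e ⟨he, hde⟩)
      · exact Or.inl (not_lt.mp hde)
    · rw [Finset.not_nonempty_iff_eq_empty, Finset.filter_eq_empty_iff] at h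
      have hmax : ∀ e, p e = p d → θ e ≤ θ d := fun e he =>
        not_lt.mp fun hlt => h (Finset.mem_univ e) ⟨he, hlt⟩
      obtain ⟨m, hm, hmin⟩ := Finset.exists_min_image (Finset.univ.filter fun e => p e = p d) θ
        ⟨d, by simp⟩
      simp only [Finset.mem_filter, Finset.mem_univ, true_and] at hm hmin
      exact ⟨m, hm, Or.inr ⟨hmax m hm, fun e he => ⟨hmin e he, hmax e he⟩⟩⟩
  choose next hp hn using hnext
  have hbij : Function.Injective next := by
    intro d e hde
    have hpe : p e = p d := by rw [← hp d, ← hp e, hde]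
    refine hinj d e hpe.symm ?_
    have h1 := hn d
    have h2 := hn e
    rw [← hde] at h2
    rcases h1 with ⟨a1, b1⟩ | ⟨a1, b1⟩ <;> rcases h2 with ⟨a2, b2⟩ | ⟨a2, b2⟩
    · have c1 := b1 e hpe
      have c2 := b2 d hpe.symm
      rcases c1 with c1 | c1 <;> rcases c2 with c2 | c2 <;> linarith
    · have := (b2 d hpe.symm).1
      linarith
    · have := (b1 e hpe).1
      linarith
    · have := (b1 e hpe).2
      have := (b2 d hpe.symm).2
      linarith
  let σ : Equiv.Perm D := Equiv.ofBijective next (Finite.injective_iff_bijective.mp hbij)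
  refine ⟨σ, hp, ?_, hn⟩
  -- Stepping backwards lowers θ until the minimum of the fibre, which is unique, is reached; so
  -- each fibre is one cycle.
  have hmin : ∀ d, ∃ m, p m = p d ∧ (∀ e, p e = p d → θ m ≤ θ e) ∧ σ.SameCycle m d := by
    intro d
    induction hk : (Finset.univ.filter fun e => p e = p d ∧ θ e < θ d).card using
      Nat.strong_induction_on generalizing d with
    | _ k ih =>
    have hs : σ (σ.symm d) = d := σ.apply_symm_apply d
    have hps : p (σ.symm d) = p d := by
      conv_rhs => rw [← hs]
      exact (hp _).symm
    have h := hn (σ.symm d)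
    change (θ _ < θ (σ (σ.symm d)) ∧ _) ∨ (θ (σ (σ.symm d)) ≤ _ ∧
      ∀ e, _ → θ (σ (σ.symm d)) ≤ θ e ∧ _) at h
    rw [hs, hps] at h
    rcases h with ⟨hlt, -⟩ | ⟨-, h⟩
    · obtain ⟨m, hm1, hm2, hm3⟩ := ih _ (by
        rw [← hk]
        refine Finset.card_lt_card ?_
        rw [Finset.ssubset_iff_of_subset]
        · exact ⟨σ.symm d, by simp [hps, hlt], by simp⟩
        · intro e he
          simp only [Finset.mem_filter, Finset.mem_univ, true_and, hps] at he ⊢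
          exact ⟨he.1, he.2.trans hlt⟩) (σ.symm d) rfl
      rw [hps] at hm1 hm2
      exact ⟨m, hm1, hm2, hm3.trans ⟨1, by simp⟩⟩
    · exact ⟨d, rfl, fun e he => (h e he).1, Equiv.Perm.SameCycle.refl _ _⟩
  intro d e hde
  obtain ⟨m, hm1, hm2, hm3⟩ := hmin d
  obtain ⟨m', hm1', hm2', hm3'⟩ := hmin e
  have : m = m' := by
    refine hinj m m' (by rw [hm1, hm1', hde]) (le_antisymm ?_ ?_)
    · exact hm2 m' (by rw [hm1', hde])
    · exact hm2' m (by rw [hm1, hde])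
  subst this
  exact hm3.symm.trans hm3'

/-! ### Counterclockwise order of the segments at a point -/

namespace SegmentSystem

open Complex

variable {S : Type*} (Q : SegmentSystem S)

/-- The direction of a traversed segment. -/
noncomputable def angle (d : S × Bool) : ℝ := arg (Q.tip d - Q.base d)

theorem tip_eq (d : S × Bool) :
    Q.tip d = Q.base d + ‖Q.tip d - Q.base d‖ * exp (Q.angle d * I) := by
  rw [angle, norm_mul_exp_arg_mul_I]
  ring

theorem norm_tip_sub_pos (d : S × Bool) : 0 < ‖Q.tip d - Q.base d‖ :=
  norm_pos_iff.mpr (sub_ne_zero.mpr (Q.base_ne_tip d).symm)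

theorem angle_eq_of_tip {d : S × Bool} {q t : ℝ} (hq : 0 < q) (ht : t ∈ Set.Ioc (-Real.pi) Real.pi)
    (h : Q.tip d = Q.base d + q * exp (t * I)) : Q.angle d = t := by
  rw [angle, h, add_sub_cancel_left, arg_real_mul _ hq, arg_exp_mul_I, toIocMod_eq_self]
  rwa [show -Real.pi + 2 * Real.pi = Real.pi by ring]

theorem eq_of_angle_eq {d d' : S × Bool} (hb : Q.base d = Q.base d') (h : Q.angle d = Q.angle d') :
    d = d' :=
  Q.eq_of_same_direction hb (Q.norm_tip_sub_pos d) (Q.norm_tip_sub_pos d') (Q.tip_eq d)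
    (by rw [h]; exact Q.tip_eq d')

/-- The left value of a traversed segment is the right value of the next one in counterclockwise
order. -/
theorem IsCirculation.leftValue_eq_rightValue_of_next [Fintype S] {Q : SegmentSystem S} {z : S → ℤ}
    (hz : Q.IsCirculation z) {d d' : S × Bool} (hb : Q.base d' = Q.base d)
    (h : (Q.angle d < Q.angle d' ∧
        ∀ e, Q.base e = Q.base d → Q.angle e ≤ Q.angle d ∨ Q.angle d' ≤ Q.angle e) ∨
      (Q.angle d' ≤ Q.angle d ∧
        ∀ e, Q.base e = Q.base d → Q.angle d' ≤ Q.angle e ∧ Q.angle e ≤ Q.angle d)) :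
    Q.leftValue z d = Q.rightValue z d' := by
  have hd := arg_mem_Ioc (Q.tip d - Q.base d)
  have hd' := arg_mem_Ioc (Q.tip d' - Q.base d')
  change Q.angle d ∈ _ at hd
  change Q.angle d' ∈ _ at hd'
  have hpi := Real.pi_pos
  rcases h with ⟨hlt, hgap⟩ | ⟨hle, hgap⟩
  · refine hz.leftValue_eq_rightValue hb (Q.norm_tip_sub_pos d) (Q.norm_tip_sub_pos d') hlt
      (Q.tip_eq d) (Q.tip_eq d') fun e he t ht q hq heq => ?_
    have := Q.angle_eq_of_tip hq ⟨hd.1.trans ht.1, ht.2.le.trans hd'.2⟩ heq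
    rcases hgap e he with h | h
    · linarith [ht.1]
    · linarith [ht.2]
  -- The sector crosses the branch cut, so the angle of `d'` is raised by a full turn. This includes
  -- the case of a lone segment, `d' = d`.
  · have htip : Q.tip d' = Q.base d' + ‖Q.tip d' - Q.base d'‖ *
        exp ((Q.angle d' + 2 * Real.pi : ℝ) * I) := by
      have : exp ((Q.angle d' + 2 * Real.pi : ℝ) * I) = exp (Q.angle d' * I) := by
        push_cast
        rw [add_mul, exp_periodic]
      rw [this]
      exact Q.tip_eq d'
    refine hz.leftValue_eq_rightValue hb (Q.norm_tip_sub_pos d) (Q.norm_tip_sub_pos d')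
      (by linarith [hd.2, hd'.1]) (Q.tip_eq d) htip fun e he t ht q hq heq => ?_
    by_cases htp : t ≤ Real.pi
    · have := Q.angle_eq_of_tip hq ⟨hd.1.trans ht.1, htp⟩ heq
      linarith [ht.1, (hgap e he).2]
    · push Not at htp
      have heq' : Q.tip e = Q.base e + q * exp ((t - 2 * Real.pi : ℝ) * I) := by
        have : exp ((t - 2 * Real.pi : ℝ) * I) = exp (t * I) := by
          push_cast
          rw [sub_mul, exp_periodic.sub_eq]
        rw [this]
        exact heq
      have := Q.angle_eq_of_tip hq ⟨by linarith, by linarith [ht.2, hd'.2]⟩ heq'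
      linarith [ht.2, (hgap e he).1]

end SegmentSystem

/-! ### Polygonal arcs and plane drawings as segment systems -/

namespace PolygonalArc

variable (γ : PolygonalArc)

/-- A corner lies on the adjacent segments only. -/
theorem eq_of_corner_mem {j : Fin (γ.n + 1)} {i : Fin γ.n}
    (h : γ.corner j ∈ segment ℝ (γ.corner i.castSucc) (γ.corner i.succ)) :
    j = i.castSucc ∨ j = i.succ := by
  by_contra! hne
  obtain ⟨h1, h2⟩ := hne
  rw [ne_eq, Fin.ext_iff, Fin.val_castSucc] at h1
  rw [ne_eq, Fin.ext_iff, Fin.val_succ] at h2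
  rcases lt_or_ge j.val i.val with hlt | hge
  · let k : Fin γ.n := ⟨j.val, hlt.trans i.isLt⟩
    have hk : j = k.castSucc := Fin.ext rfl
    rw [hk] at h
    obtain ⟨-, h4⟩ := γ.simple k i hlt _ (left_mem_segment ℝ _ _) h
    exact γ.nondegenerate k h4
  · have hj := j.isLt
    let k : Fin γ.n := ⟨j.val - 1, by omega⟩
    have hk : j = k.succ := Fin.ext (by simp only [Fin.val_succ, k]; omega)
    have hik : i < k := by simp only [Fin.lt_def, k]; omega
    rw [hk] at h
    obtain ⟨h3, h4⟩ := γ.simple i k hik _ h (right_mem_segment ℝ _ _)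
    rw [h3] at h4
    exact γ.nondegenerate k h4.symm

theorem corner_injective : Function.Injective γ.corner := by
  have key : ∀ j j' : Fin (γ.n + 1), j < j' → γ.corner j ≠ γ.corner j' := by
    intro j j' hlt heq
    have hj := j'.isLt
    rw [Fin.lt_def] at hlt
    let k : Fin γ.n := ⟨j'.val - 1, by omega⟩
    have hk : j' = k.succ := Fin.ext (by simp only [Fin.val_succ, k]; omega)
    rw [hk] at heq
    have hmem : γ.corner j ∈ segment ℝ (γ.corner k.castSucc) (γ.corner k.succ) :=
      heq ▸ right_mem_segment ℝ _ _
    rcases γ.eq_of_corner_mem hmem with h | h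
    · rw [h] at heq
      exact γ.nondegenerate k heq
    · rw [h, ← hk] at hlt
      exact lt_irrefl _ hlt
  intro j j' heq
  rcases lt_trichotomy j j' with h | h | h
  · exact absurd heq (key j j' h)
  · exact h
  · exact absurd heq.symm (key j' j h)

end PolygonalArc

namespace SimpleGraph.PlaneDrawing

variable {V : Type*} {G : SimpleGraph V} (P : G.PlaneDrawing)

/-- The Euclidean plane as the complex plane. -/
noncomputable def toComplex : EuclideanSpace ℝ (Fin 2) ≃ₗᵢ[ℝ] ℂ :=
  Complex.orthonormalBasisOneI.repr.symm

theorem toComplex_mem_segment {x a b : EuclideanSpace ℝ (Fin 2)} :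
    toComplex x ∈ segment ℝ (toComplex a) (toComplex b) ↔ x ∈ segment ℝ a b := by
  have h := image_segment ℝ (toComplex.toLinearEquiv : EuclideanSpace ℝ (Fin 2) →ₗ[ℝ] ℂ).toAffineMap a b
  change toComplex '' _ = segment ℝ (toComplex a) (toComplex b) at h
  rw [← h]
  exact toComplex.injective.mem_set_image

theorem exists_ends (e : G.edgeSet) : ∃ u v : V, (e : Sym2 V) = s(u, v) ∧
    (P.arc e).start = P.pos u ∧ (P.arc e).finish = P.pos v := by
  have h := P.ends_arc e
  obtain ⟨e, he⟩ := e
  induction e using Sym2.ind with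
  | _ u v =>
  rw [Sym2.map_mk, Sym2.eq_iff] at h
  rcases h with ⟨h1, h2⟩ | ⟨h1, h2⟩
  · exact ⟨u, v, rfl, h1, h2⟩
  · exact ⟨v, u, Sym2.eq_swap, h1, h2⟩

/-- The vertex at which the arc of an edge starts. -/
noncomputable def tail (e : G.edgeSet) : V := (P.exists_ends e).choose

/-- The vertex at which the arc of an edge finishes. -/
noncomputable def head (e : G.edgeSet) : V := (P.exists_ends e).choose_spec.choose

theorem eq_tail_head (e : G.edgeSet) : (e : Sym2 V) = s(P.tail e, P.head e) :=
  (P.exists_ends e).choose_spec.choose_spec.1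

theorem start_arc (e : G.edgeSet) : (P.arc e).start = P.pos (P.tail e) :=
  (P.exists_ends e).choose_spec.choose_spec.2.1

theorem finish_arc (e : G.edgeSet) : (P.arc e).finish = P.pos (P.head e) :=
  (P.exists_ends e).choose_spec.choose_spec.2.2

theorem tail_adj_head (e : G.edgeSet) : G.Adj (P.tail e) (P.head e) := by
  have := e.2
  rwa [P.eq_tail_head e, mem_edgeSet] at this

theorem n_pos (e : G.edgeSet) : 0 < (P.arc e).n := by
  by_contra! h
  have h0 : (0 : Fin ((P.arc e).n + 1)) = Fin.last _ := Fin.ext (by simp; omega)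
  have : (P.arc e).start = (P.arc e).finish := by
    unfold PolygonalArc.start PolygonalArc.finish
    rw [h0]
  rw [start_arc, finish_arc] at this
  exact (P.tail_adj_head e).ne (P.pos_injective this)

/-- The first segment of the arc of an edge. -/
def first (e : G.edgeSet) : Fin (P.arc e).n := ⟨0, P.n_pos e⟩

/-- The last segment of the arc of an edge. -/
def last (e : G.edgeSet) : Fin (P.arc e).n :=
  ⟨(P.arc e).n - 1, by have := P.n_pos e; omega⟩

theorem corner_first (e : G.edgeSet) :
    (P.arc e).corner (P.first e).castSucc = P.pos (P.tail e) := P.start_arc e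

theorem succ_last (e : G.edgeSet) : (P.last e).succ = Fin.last _ := by
  have := P.n_pos e
  exact Fin.ext (by simp [last]; omega)

theorem corner_last (e : G.edgeSet) :
    (P.arc e).corner (P.last e).succ = P.pos (P.head e) := by
  rw [succ_last]
  exact P.finish_arc e

theorem mem_carrier {e : G.edgeSet} {x : EuclideanSpace ℝ (Fin 2)} (i : Fin (P.arc e).n)
    (h : x ∈ segment ℝ ((P.arc e).corner i.castSucc) ((P.arc e).corner i.succ)) :
    x ∈ (P.arc e).carrier := Set.mem_iUnion.mpr ⟨i, h⟩

theorem corner_mem_carrier (e : G.edgeSet) (j : Fin ((P.arc e).n + 1)) :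
    (P.arc e).corner j ∈ (P.arc e).carrier := by
  have hn := P.n_pos e
  by_cases hj : j.val < (P.arc e).n
  · exact P.mem_carrier ⟨j.val, hj⟩ (left_mem_segment ℝ _ _)
  · have : j = (P.last e).succ := by
      rw [succ_last]
      exact Fin.ext (by simp; omega)
    rw [this]
    exact P.mem_carrier _ (right_mem_segment ℝ _ _)

/-- The corners of an arc that are vertices are its ends. -/
theorem corner_eq_pos {e : G.edgeSet} {j : Fin ((P.arc e).n + 1)} {v : V}
    (h : (P.arc e).corner j = P.pos v) : (j = 0 ∧ v = P.tail e) ∨ (j = Fin.last _ ∧ v = P.head e) := by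
  have hv : v ∈ (e : Sym2 V) := P.mem_of_pos_mem e v (h ▸ P.corner_mem_carrier e j)
  rw [P.eq_tail_head e, Sym2.mem_iff] at hv
  rcases hv with hv | hv
  · refine Or.inl ⟨(P.arc e).corner_injective ?_, hv⟩
    rw [h, hv]
    exact (P.start_arc e).symm
  · refine Or.inr ⟨(P.arc e).corner_injective ?_, hv⟩
    rw [h, hv]
    exact (P.finish_arc e).symm

theorem eq_end_of_pos_mem_segment {e : G.edgeSet} {i : Fin (P.arc e).n} {v : V}
    (h : P.pos v ∈ segment ℝ ((P.arc e).corner i.castSucc) ((P.arc e).corner i.succ)) :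
    P.pos v = (P.arc e).corner i.castSucc ∨ P.pos v = (P.arc e).corner i.succ := by
  have hv : v ∈ (e : Sym2 V) := P.mem_of_pos_mem e v (P.mem_carrier i h)
  obtain ⟨j, hj⟩ : ∃ j, P.pos v = (P.arc e).corner j := by
    rw [P.eq_tail_head e, Sym2.mem_iff] at hv
    rcases hv with hv | hv
    · exact ⟨0, by rw [hv]; exact (P.start_arc e).symm⟩
    · exact ⟨Fin.last _, by rw [hv]; exact (P.finish_arc e).symm⟩
  rw [hj] at h ⊢
  exact ((P.arc e).eq_of_corner_mem h).imp (congrArg _) (congrArg _)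

/-- All segments of a drawing. -/
noncomputable def segments : SegmentSystem (Σ e : G.edgeSet, Fin (P.arc e).n) where
  a s := toComplex ((P.arc s.1).corner s.2.castSucc)
  b s := toComplex ((P.arc s.1).corner s.2.succ)
  ne s := fun h => (P.arc s.1).nondegenerate s.2 (toComplex.injective h)
  inter := by
    rintro ⟨e, i⟩ ⟨e', i'⟩ hne x hx hx'
    obtain ⟨y, rfl⟩ := toComplex.surjective x
    rw [toComplex_mem_segment] at hx hx'
    simp only [toComplex.injective.eq_iff]
    by_cases he : e = e'
    · subst he
      have hi : i ≠ i' := fun h => hne (by rw [h])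
      rcases lt_or_gt_of_ne hi with hlt | hlt
      · obtain ⟨h1, h2⟩ := (P.arc e).simple i i' hlt y hx hx'
        exact ⟨Or.inr h2, Or.inl (by rw [h2, h1])⟩
      · obtain ⟨h1, h2⟩ := (P.arc e).simple i' i hlt y hx' hx
        exact ⟨Or.inl (by rw [h2, h1]), Or.inr h2⟩
    · obtain ⟨v, -, -, rfl⟩ := P.inter_arc e e' he y (P.mem_carrier i hx) (P.mem_carrier i' hx')
      exact ⟨P.eq_end_of_pos_mem_segment hx, P.eq_end_of_pos_mem_segment hx'⟩

/-- The traversed segment with which an edge leaves its tail (`true`) or its head (`false`). -/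
def germAt (e : G.edgeSet) (o : Bool) : (Σ e : G.edgeSet, Fin (P.arc e).n) × Bool :=
  (⟨e, if o then P.first e else P.last e⟩, o)

theorem base_germAt_true (e : G.edgeSet) :
    P.segments.base (P.germAt e true) = toComplex (P.pos (P.tail e)) := by
  rw [← P.corner_first e]; rfl

theorem base_germAt_false (e : G.edgeSet) :
    P.segments.base (P.germAt e false) = toComplex (P.pos (P.head e)) := by
  rw [← P.corner_last e]; rfl

/-- The edge of a dart. -/
def edgeOf (d : G.Dart) : G.edgeSet := ⟨d.edge, d.edge_mem⟩

open Classical in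
/-- The traversed segment with which a dart leaves its first vertex. -/
noncomputable def germ (d : G.Dart) : (Σ e : G.edgeSet, Fin (P.arc e).n) × Bool :=
  P.germAt (edgeOf d) (decide (d.fst = P.tail (edgeOf d)))

theorem edgeOf_symm (d : G.Dart) : edgeOf d.symm = edgeOf d := Subtype.ext d.edge_symm

theorem dart_cases (d : G.Dart) :
    (d.fst = P.tail (edgeOf d) ∧ d.snd = P.head (edgeOf d) ∧
      P.germ d = P.germAt (edgeOf d) true ∧ P.germ d.symm = P.germAt (edgeOf d) false) ∨
    (d.fst = P.head (edgeOf d) ∧ d.snd = P.tail (edgeOf d) ∧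
      P.germ d = P.germAt (edgeOf d) false ∧ P.germ d.symm = P.germAt (edgeOf d) true) := by
  have h : s(d.fst, d.snd) = s(P.tail (edgeOf d), P.head (edgeOf d)) := P.eq_tail_head (edgeOf d)
  have hne := (P.tail_adj_head (edgeOf d)).ne
  have hs : d.symm.fst = d.snd := rfl
  rw [Sym2.eq_iff] at h
  rcases h with ⟨h1, h2⟩ | ⟨h1, h2⟩
  · refine Or.inl ⟨h1, h2, ?_, ?_⟩
    · simp [germ, h1]
    · rw [germ, edgeOf_symm, hs, h2]
      simp [hne.symm]
  · refine Or.inr ⟨h1, h2, ?_, ?_⟩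
    · simp [germ, h1, hne.symm]
    · rw [germ, edgeOf_symm, hs, h2]
      simp

theorem base_germ (d : G.Dart) : P.segments.base (P.germ d) = toComplex (P.pos d.fst) := by
  rcases P.dart_cases d with ⟨h1, -, h2, -⟩ | ⟨h1, -, h2, -⟩
  · rw [h2, base_germAt_true, h1]
  · rw [h2, base_germAt_false, h1]

theorem germ_injective_of_fst {d d' : G.Dart} (hf : d.fst = d'.fst) (h : P.germ d = P.germ d') :
    d = d' := by
  have he : edgeOf d = edgeOf d' := congrArg (fun x => x.1.1) h
  have he' : d.edge = d'.edge := congrArg Subtype.val he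
  rcases (dart_edge_eq_iff d d').mp he' with h | h
  · exact h
  · exfalso
    rw [h] at hf
    exact d'.adj.ne hf.symm

/-- Every traversed segment that starts at a vertex is the germ of a dart. -/
theorem exists_germ {ε : (Σ e : G.edgeSet, Fin (P.arc e).n) × Bool} {v : V}
    (h : P.segments.base ε = toComplex (P.pos v)) : ∃ d : G.Dart, d.fst = v ∧ P.germ d = ε := by
  have mk : ∀ e : G.edgeSet, ∃ d : G.Dart, d.fst = P.tail e ∧ d.snd = P.head e ∧ edgeOf d = e :=
    fun e => ⟨⟨(P.tail e, P.head e), P.tail_adj_head e⟩, rfl, rfl,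
      Subtype.ext (P.eq_tail_head e).symm⟩
  obtain ⟨⟨e, i⟩, o⟩ := ε
  obtain ⟨d, hd1, hd2, hd3⟩ := mk e
  subst hd3
  have hne := (P.tail_adj_head (edgeOf d)).ne
  cases o
  · have hb : (P.arc (edgeOf d)).corner i.succ = P.pos v := toComplex.injective h
    rcases P.corner_eq_pos hb with ⟨h0, -⟩ | ⟨h0, h1⟩
    · exact absurd h0 (Fin.succ_ne_zero i)
    · refine ⟨d.symm, hd2.trans h1.symm, ?_⟩
      have hi : P.last (edgeOf d) = i := by
        rw [← P.succ_last] at h0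
        exact (Fin.succ_injective _ h0).symm
      rcases P.dart_cases d with ⟨-, -, -, h3⟩ | ⟨h3, -⟩
      · rw [h3, germAt]
        simp [hi]
      · exact absurd (hd1.symm.trans h3) hne
  · have hb : (P.arc (edgeOf d)).corner i.castSucc = P.pos v := toComplex.injective h
    rcases P.corner_eq_pos hb with ⟨h0, h1⟩ | ⟨h0, -⟩
    · refine ⟨d, hd1.trans h1.symm, ?_⟩
      have hi : P.first (edgeOf d) = i := by
        rw [Fin.ext_iff] at h0
        exact Fin.ext h0.symm
      rcases P.dart_cases d with ⟨-, -, h3, -⟩ | ⟨h3, -⟩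
      · rw [h3, germAt]
        simp [hi]
      · exact absurd (hd1.symm.trans h3) hne
    · exact absurd h0 (Fin.castSucc_lt_last i).ne

end SimpleGraph.PlaneDrawing

theorem Fin.sum_succ_sub_castSucc {M : Type*} [AddCommGroup M] {n : ℕ} (h : Fin (n + 1) → M) :
    ∑ i : Fin n, (h i.succ - h i.castSucc) = h (Fin.last n) - h 0 := by
  rw [Finset.sum_sub_distrib, sub_eq_sub_iff_add_eq_add, add_comm, ← Fin.sum_univ_succ,
    Fin.sum_univ_castSucc, add_comm]

/-! ### Euler's inequality from circulations -/

namespace SimpleGraph.PlaneDrawing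

variable {V : Type*} {G : SimpleGraph V} (P : G.PlaneDrawing)

open SegmentSystem

/-- A rotation system is adapted to a drawing if it follows the counterclockwise order. -/
def IsRotation (R : G.RotationSystem) : Prop :=
  ∀ d, (P.segments.angle (P.germ d) < P.segments.angle (P.germ (R.rot d)) ∧
      ∀ e : G.Dart, e.fst = d.fst → P.segments.angle (P.germ e) ≤ P.segments.angle (P.germ d) ∨
        P.segments.angle (P.germ (R.rot d)) ≤ P.segments.angle (P.germ e)) ∨
    (P.segments.angle (P.germ (R.rot d)) ≤ P.segments.angle (P.germ d) ∧
      ∀ e : G.Dart, e.fst = d.fst →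
        P.segments.angle (P.germ (R.rot d)) ≤ P.segments.angle (P.germ e) ∧
        P.segments.angle (P.germ e) ≤ P.segments.angle (P.germ d))

theorem exists_isRotation [Finite G.Dart] : ∃ R : G.RotationSystem, P.IsRotation R := by
  obtain ⟨σ, h1, h2, h3⟩ := exists_cyclic_successor (fun d : G.Dart => d.fst)
    (fun d => P.segments.angle (P.germ d)) (fun d e hde h =>
      P.germ_injective_of_fst hde (P.segments.eq_of_angle_eq (by
        rw [base_germ, base_germ]; exact congrArg _ (congrArg _ hde)) h))
  exact ⟨⟨σ, h1, h2⟩, h3⟩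

variable [Fintype G.edgeSet]

/-- An integer weight on the edges, as a weight on the segments. -/
def lift (z : G.edgeSet → ℤ) : (Σ e : G.edgeSet, Fin (P.arc e).n) → ℤ := fun s => z s.1

variable {P} {z : G.edgeSet → ℤ} (hz : P.segments.IsCirculation (P.lift z))
include hz

/-- The total angle to the left of an arc does not change at a corner. -/
theorem leftValue_corner (e : G.edgeSet) {i j : Fin (P.arc e).n} (hij : i.succ = j.castSucc) :
    P.segments.leftValue (P.lift z) (⟨e, j⟩, true) =
      P.segments.leftValue (P.lift z) (⟨e, i⟩, true) := by
  set d : (Σ e : G.edgeSet, Fin (P.arc e).n) × Bool := (⟨e, j⟩, true) with hd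
  set d' : (Σ e : G.edgeSet, Fin (P.arc e).n) × Bool := (⟨e, i⟩, false) with hd'
  change _ = P.segments.rightValue (P.lift z) d'
  have hb : P.segments.base d' = P.segments.base d := by
    change toComplex ((P.arc e).corner i.succ) = toComplex ((P.arc e).corner j.castSucc)
    rw [hij]
  -- Only the two adjacent segments of the arc end at an interior corner, so each of the two sectors
  -- there is empty.
  have hall : ∀ ε, P.segments.base ε = P.segments.base d → ε = d ∨ ε = d' := by
    rintro ⟨⟨e', k⟩, o⟩ hε
    have hcase : ∃ l, (P.arc e').corner l = (P.arc e).corner j.castSucc ∧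
        l = if o then k.castSucc else k.succ := by
      cases o
      · exact ⟨_, toComplex.injective hε, rfl⟩
      · exact ⟨_, toComplex.injective hε, rfl⟩
    obtain ⟨l, hl, hlk⟩ := hcase
    by_cases he : e' = e
    · subst he
      have hl' := (P.arc e').corner_injective hl
      rw [hl'] at hlk
      cases o
      · right
        rw [← hij] at hlk
        have : i = k := Fin.succ_injective _ hlk
        rw [hd', this]
      · left
        have : j = k := Fin.castSucc_injective _ hlk
        rw [hd, this]
    · exfalso
      obtain ⟨v, -, -, hx⟩ := P.inter_arc e' e he _ (P.corner_mem_carrier e' l)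
        (hl ▸ P.corner_mem_carrier e j.castSucc)
      rw [hl] at hx
      rcases P.corner_eq_pos hx with ⟨h0, -⟩ | ⟨h0, -⟩
      · rw [← hij] at h0
        exact Fin.succ_ne_zero i h0
      · exact (Fin.castSucc_lt_last j).ne h0
  refine hz.leftValue_eq_rightValue_of_next hb ?_
  rcases lt_or_ge (P.segments.angle d) (P.segments.angle d') with h | h
  · refine Or.inl ⟨h, fun ε hε => ?_⟩
    rcases hall ε hε with rfl | rfl
    · exact Or.inl le_rfl
    · exact Or.inr le_rfl
  · refine Or.inr ⟨h, fun ε hε => ?_⟩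
    rcases hall ε hε with rfl | rfl
    · exact ⟨h, le_rfl⟩
    · exact ⟨le_rfl, h⟩

theorem leftValue_arc (e : G.edgeSet) (k : ℕ) (hk : k < (P.arc e).n) :
    P.segments.leftValue (P.lift z) (⟨e, ⟨k, hk⟩⟩, true) =
      P.segments.leftValue (P.lift z) (⟨e, P.first e⟩, true) := by
  induction k with
  | zero => rfl
  | succ k ih =>
    rw [← ih (by omega)]
    exact leftValue_corner hz e (Fin.ext rfl)

theorem leftValue_last (e : G.edgeSet) :
    P.segments.leftValue (P.lift z) (⟨e, P.last e⟩, true) =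
      P.segments.leftValue (P.lift z) (⟨e, P.first e⟩, true) :=
  leftValue_arc hz e _ _

omit hz in
theorem leftValue_false (s : Σ e : G.edgeSet, Fin (P.arc e).n) :
    P.segments.leftValue (P.lift z) (s, false) =
      P.segments.leftValue (P.lift z) (s, true) - z s.1 * (2 * Real.pi) := by
  simp [leftValue, lift]

/-- The two sides of an edge differ by its weight. -/
theorem leftValue_germAt_sub (e : G.edgeSet) :
    P.segments.leftValue (P.lift z) (P.germAt e true) -
      P.segments.leftValue (P.lift z) (P.germAt e false) = z e * (2 * Real.pi) := by
  simp only [germAt, if_true, Bool.false_eq_true, if_false]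
  rw [leftValue_false, leftValue_last hz]
  ring

/-- The two germs lie at opposite ends of one arc, along which the value on a fixed side does not
change. -/
theorem rightValue_germ_symm (d : G.Dart) :
    P.segments.rightValue (P.lift z) (P.germ d.symm) =
      P.segments.leftValue (P.lift z) (P.germ d) := by
  rcases P.dart_cases d with ⟨-, -, h1, h2⟩ | ⟨-, -, h1, h2⟩
  · rw [h1, h2]
    exact leftValue_last hz _
  · rw [h1, h2]
    change P.segments.leftValue _ (⟨_, P.first _⟩, false) =
      P.segments.leftValue _ (⟨_, P.last _⟩, false)
    rw [leftValue_false, leftValue_false, leftValue_last hz]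

theorem leftValue_rot {R : G.RotationSystem} (hR : P.IsRotation R) (d : G.Dart) :
    P.segments.leftValue (P.lift z) (P.germ d) =
      P.segments.rightValue (P.lift z) (P.germ (R.rot d)) := by
  have key : ∀ ε, P.segments.base ε = P.segments.base (P.germ d) →
      ∃ e : G.Dart, e.fst = d.fst ∧ P.germ e = ε := by
    intro ε hε
    rw [base_germ] at hε
    exact P.exists_germ hε
  refine hz.leftValue_eq_rightValue_of_next ?_ ?_
  · rw [base_germ, base_germ, R.fst_rot]
  · refine (hR d).imp (fun h => ⟨h.1, fun ε hε => ?_⟩) (fun h => ⟨h.1, fun ε hε => ?_⟩)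
    · obtain ⟨e, he, rfl⟩ := key ε hε
      exact h.2 e he
    · obtain ⟨e, he, rfl⟩ := key ε hε
      exact h.2 e he

/-- A facial step follows one side of an arc and then crosses the empty sector between consecutive
darts; neither changes the value. -/
theorem leftValue_face {R : G.RotationSystem} (hR : P.IsRotation R) (d : G.Dart) :
    P.segments.leftValue (P.lift z) (P.germ (R.face d)) =
      P.segments.leftValue (P.lift z) (P.germ d) := by
  rw [leftValue_rot hz hR, R.rot_face, rightValue_germ_symm hz]

theorem leftValue_sameCycle [Finite G.Dart] {R : G.RotationSystem} (hR : P.IsRotation R)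
    {d e : G.Dart} (h : R.face.SameCycle d e) :
    P.segments.leftValue (P.lift z) (P.germ d) = P.segments.leftValue (P.lift z) (P.germ e) := by
  obtain ⟨i, rfl⟩ := h.exists_nat_pow_eq
  clear h
  induction i with
  | zero => rfl
  | succ i ih => rw [ih, pow_succ', Equiv.Perm.mul_apply, leftValue_face hz hR]

omit hz in
/-- A weight that satisfies Kirchhoff's law at all vertices but one lifts to a circulation. -/
theorem isCirculation_lift [Fintype V] [DecidableEq V] (v₀ : V)
    (h : ∀ v, v ≠ v₀ → ∑ e, z e * ((if P.head e = v then 1 else 0) -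
      (if P.tail e = v then 1 else 0)) = 0) : P.segments.IsCirculation (P.lift z) := by
  intro g
  -- Differences ignore constants, so `g` may be normalised to vanish at `v₀`, where Kirchhoff's law
  -- is not assumed.
  let k : V → Real.Angle := fun v => g (toComplex (P.pos v)) - g (toComplex (P.pos v₀))
  have h1 : ∑ s, P.lift z s • (g (P.segments.b s) - g (P.segments.a s)) =
      ∑ e, z e • (k (P.head e) - k (P.tail e)) := by
    rw [Fintype.sum_sigma]
    refine Finset.sum_congr rfl fun e _ => ?_
    have := Fin.sum_succ_sub_castSucc fun j => g (toComplex ((P.arc e).corner j))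
    simp only [lift, ← Finset.smul_sum]
    congr 1
    refine this.trans ?_
    simp only [k]
    rw [← P.start_arc, ← P.finish_arc, sub_sub_sub_cancel_right]
    rfl
  have h2 : ∀ e, z e • (k (P.head e) - k (P.tail e)) =
      ∑ v, (z e * ((if P.head e = v then 1 else 0) - (if P.tail e = v then 1 else 0))) • k v := by
    intro e
    simp only [mul_smul, sub_smul, smul_sub, Finset.sum_sub_distrib, ite_smul, one_smul, zero_smul,
      smul_ite, smul_zero, Finset.sum_ite_eq, Finset.mem_univ, if_true]
  rw [h1, Finset.sum_congr rfl fun e _ => h2 e, Finset.sum_comm]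
  refine Finset.sum_eq_zero fun v _ => ?_
  rw [← Finset.sum_smul]
  by_cases hv : v = v₀
  · simp [k, hv]
  · rw [h v hv, zero_smul]

omit hz in
/-- Euler's inequality for plane drawings. -/
theorem euler [Fintype V] [DecidableRel G.Adj] {R : G.RotationSystem} (hR : P.IsRotation R)
    (d₀ : G.Dart) :
    G.edgeFinset.card + 1 ≤ Nat.card {v // 0 < G.degree v} +
      Nat.card (Quotient (Equiv.Perm.SameCycle.setoid R.face)) := by
  classical
  let F := Quotient (Equiv.Perm.SameCycle.setoid R.face)
  have : Fintype F := Fintype.ofFinite _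
  -- Kirchhoff's law is imposed at all non-isolated vertices but one; the omitted vertex yields the
  -- + 1 in the inequality.
  let X := {v // 0 < G.degree v ∧ v ≠ d₀.fst}
  let B : Matrix X G.edgeSet ℤ := fun v e =>
    (if P.head e = v then 1 else 0) - (if P.tail e = v then 1 else 0)
  let f := B.mulVecLin
  have hcirc : ∀ z : LinearMap.ker f, P.segments.IsCirculation (P.lift (z : G.edgeSet → ℤ)) := by
    rintro ⟨z, hz⟩
    refine isCirculation_lift d₀.fst fun v hv => ?_
    by_cases hdeg : 0 < G.degree v
    · have : ∑ e, B ⟨v, hdeg, hv⟩ e * z e = 0 :=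
        congrFun (LinearMap.mem_ker.mp hz) ⟨v, hdeg, hv⟩
      exact (Finset.sum_congr rfl fun e _ => mul_comm _ _).trans this
    · refine Finset.sum_eq_zero fun e _ => ?_
      have h1 : P.head e ≠ v := by
        rintro rfl
        exact hdeg ((G.degree_pos_iff_exists_adj _).mpr ⟨_, (P.tail_adj_head e).symm⟩)
      have h2 : P.tail e ≠ v := by
        rintro rfl
        exact hdeg ((G.degree_pos_iff_exists_adj _).mpr ⟨_, P.tail_adj_head e⟩)
      simp [h1, h2]
  have hturn : ∀ (z : LinearMap.ker f) (d : G.Dart), ∃ n : ℤ,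
      (n : ℝ) * (2 * Real.pi) = P.segments.leftValue (P.lift (z : G.edgeSet → ℤ)) (P.germ d) :=
    fun z d => (hcirc z).leftValue_mem _
  choose N hN using hturn
  have hpi : (2 * Real.pi) ≠ 0 := by positivity
  have hNF : ∀ z d e, R.face.SameCycle d e → N z d = N z e := by
    intro z d e h
    have := leftValue_sameCycle (hcirc z) hR h
    rw [← hN, ← hN] at this
    exact_mod_cast mul_right_cancel₀ hpi this
  have hNadd : ∀ z z' d, N (z + z') d = N z d + N z' d := by
    intro z z' d
    have h1 := P.segments.leftValue_add (P.lift (z : G.edgeSet → ℤ))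
      (P.lift (z' : G.edgeSet → ℤ)) (P.germ d)
    have h2 := hN (z + z') d
    have h3 : P.lift ((z + z' : LinearMap.ker f) : G.edgeSet → ℤ) =
      P.lift (z : G.edgeSet → ℤ) + P.lift (z' : G.edgeSet → ℤ) := rfl
    rw [h3, h1, ← hN, ← hN, ← add_mul] at h2
    exact_mod_cast mul_right_cancel₀ hpi h2
  let Φ : LinearMap.ker f →+ (F → ℤ) := AddMonoidHom.mk' (fun z => Quotient.lift (N z) (hNF z)) (by
    intro z z'
    funext q
    induction q using Quotient.inductionOn with
    | h d => exact hNadd z z' d)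
  -- If all face values vanish, both sides of every edge agree, so its weight is zero.
  have hΦ : Function.Injective Φ.toIntLinearMap := by
    refine (injective_iff_map_eq_zero Φ).mpr fun z hz => ?_
    have hzero : ∀ d, N z d = 0 := fun d => congrFun hz ⟦d⟧
    refine Subtype.ext (funext fun e => ?_)
    have hd := leftValue_germAt_sub (hcirc z) e
    obtain ⟨d1, -, h1⟩ := P.exists_germ (P.base_germAt_true e)
    obtain ⟨d2, -, h2⟩ := P.exists_germ (P.base_germAt_false e)
    rw [← h1, ← h2, ← hN, ← hN, hzero, hzero, sub_self, eq_comm, mul_eq_zero] at hd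
    exact_mod_cast hd.resolve_right hpi
  -- The kernel has rank at most F and, by rank-nullity, at least E - |X|.
  have r1 := LinearMap.finrank_le_finrank_of_injective hΦ
  have r2 := (LinearMap.ker f).finrank_quotient_add_finrank
  rw [f.quotKerEquivRange.finrank_eq] at r2
  have r3 := Submodule.finrank_le (LinearMap.range f)
  rw [Module.finrank_fintype_fun_eq_card] at r1 r2 r3
  have hX : Fintype.card X + 1 = Nat.card {v // 0 < G.degree v} := by
    have hpos : 0 < G.degree d₀.fst := (G.degree_pos_iff_exists_adj _).mpr ⟨_, d₀.adj⟩
    rw [Nat.card_eq_fintype_card, Fintype.card_subtype, Fintype.card_subtype]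
    have : (Finset.univ.filter fun v => 0 < G.degree v ∧ v ≠ d₀.fst) =
        (Finset.univ.filter fun v => 0 < G.degree v).erase d₀.fst := by
      ext v
      simp [and_comm]
    rw [this]
    exact Finset.card_erase_add_one (by simp [hpos])
  have hE : G.edgeFinset.card = Fintype.card G.edgeSet := Set.toFinset_card _
  rw [hE, Nat.card_eq_fintype_card (α := Quotient _)]
  change _ ≤ _ + Fintype.card F
  omega

end SimpleGraph.PlaneDrawing

namespace SimpleGraph

/-- A planar graph with an edge and without five-cycles has a vertex of degree one, two or three. -/
theorem IsPlanar.exists_degree_le_three {V : Type*} [Fintype V] {G : SimpleGraph V}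
    [DecidableRel G.Adj] (hG : G.IsPlanar) (h5 : G.NoFiveCycle) (hne : G.edgeSet.Nonempty) :
    ∃ v, 0 < G.degree v ∧ G.degree v ≤ 3 := by
  classical
  obtain ⟨P⟩ := hG
  obtain ⟨R, hR⟩ := P.exists_isRotation
  obtain ⟨e, he⟩ := hne
  have hadj := P.tail_adj_head ⟨e, he⟩
  exact R.exists_degree_le_three h5 (PlaneDrawing.euler hR ⟨(_, _), hadj⟩)

end SimpleGraph

/-! ### Passing to subgraphs, and greedy colouring of the line graph -/

namespace SimpleGraph

variable {V : Type*} {G : SimpleGraph V}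

theorem NoFiveCycle.mono {H : SimpleGraph V} (h5 : G.NoFiveCycle) (hle : H ≤ G) :
    H.NoFiveCycle := by
  intro v p hp hl
  exact h5 v (p.mapLe hle) (hp.mapLe hle) (by simpa using hl)

theorem IsPlanar.mono {H : SimpleGraph V} (hG : G.IsPlanar) (hle : H ≤ G) : H.IsPlanar := by
  obtain ⟨P⟩ := hG
  have hsub : ∀ e, e ∈ H.edgeSet → e ∈ G.edgeSet := fun e he => edgeSet_mono hle he
  exact ⟨{
    pos := P.pos
    pos_injective := P.pos_injective
    arc := fun e => P.arc ⟨e, hsub e e.2⟩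
    ends_arc := fun e => P.ends_arc ⟨e, hsub e e.2⟩
    mem_of_pos_mem := fun e => P.mem_of_pos_mem ⟨e, hsub e e.2⟩
    inter_arc := fun e e' hne => P.inter_arc ⟨e, hsub e e.2⟩ ⟨e', hsub e' e'.2⟩
      fun h => hne (Subtype.ext (congrArg (fun x : G.edgeSet => (x : Sym2 V)) h)) }⟩

/-- Greedy colouring: a graph in which every nonempty set of vertices contains a vertex with few
neighbours in the set is group choosable. -/
theorem IsGroupChoosable.of_degenerate {W : Type u} [Fintype W] (H : SimpleGraph W) (k : ℕ)
    [DecidableRel H.Adj]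
    (hdeg : ∀ T : Finset W, T.Nonempty → ∃ x ∈ T, (T.filter fun y => H.Adj x y).card < k) :
    IsGroupChoosable.{u, w} H k := by
  classical
  intro A _ _ L hL D hD f
  let F : W → W → A := fun x y => if h : H.Adj x y then f ⟨s(x, y), H.mem_edgeSet.mpr h⟩ else 0
  -- The colouring is defined everywhere but constrained only inside `T`, so `T` can grow by one
  -- vertex at a time.
  have key : ∀ n, ∀ T : Finset W, T.card = n → ∃ c : W → A, (∀ v, c v ∈ L v) ∧
      ∀ x ∈ T, ∀ y ∈ T, D x y → c x - c y ≠ F x y := by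
    intro n
    induction n with
    | zero =>
      intro T hT
      rw [Finset.card_eq_zero] at hT
      subst hT
      by_cases hW : Nonempty W
      · obtain ⟨x, -, hx⟩ := hdeg Finset.univ (Finset.univ_nonempty_iff.mpr hW)
        have : ∀ v, ∃ a, a ∈ L v := fun v => by
          have : 0 < (L v).card := by rw [hL]; omega
          exact Finset.card_pos.mp this
        choose c hc using this
        exact ⟨c, hc, by simp⟩
      · exact ⟨fun v => absurd ⟨v⟩ hW, fun v => absurd ⟨v⟩ hW, by simp⟩
    | succ n ih =>
      intro T hT
      obtain ⟨x, hx, hxk⟩ := hdeg T (Finset.card_pos.mp (by omega))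
      obtain ⟨c, hc, hcT⟩ := ih (T.erase x) (by rw [Finset.card_erase_of_mem hx, hT]; rfl)
      -- The one colour of `x` that the edge to `y` forbids, according to its direction.
      let bad : W → A := fun y => if D x y then F x y + c y else c y - F y x
      have hlt : ((T.filter fun y => H.Adj x y).image bad).card < (L x).card := by
        rw [hL]
        exact Finset.card_image_le.trans_lt hxk
      obtain ⟨a, haL, habad⟩ := Finset.exists_mem_notMem_of_card_lt_card hlt
      have hbad : ∀ y ∈ T, H.Adj x y → a ≠ bad y := by
        rintro y hy hxy rfl
        exact habad (Finset.mem_image_of_mem _ (Finset.mem_filter.mpr ⟨hy, hxy⟩))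
      refine ⟨Function.update c x a, fun v => ?_, fun y hy z hz hyz => ?_⟩
      · by_cases hv : v = x
        · subst hv
          simpa using haL
        · simpa [hv] using hc v
      · have hadj := hD.1 y z hyz
        by_cases hyx : y = x
        · subst hyx
          have hzx : z ≠ y := hadj.ne'
          have := hbad z hz hadj
          simp only [bad, hyz, if_true] at this
          rw [Function.update_self, Function.update_of_ne hzx, ne_eq, sub_eq_iff_eq_add]
          exact this
        · by_cases hzx : z = x
          · subst hzx
            have hnot : ¬ D z y := (hD.2 y z hadj).mp hyz
            have := hbad y hy hadj.symm
            simp only [bad, hnot, if_false] at this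
            rw [Function.update_self, Function.update_of_ne hyx]
            intro h
            exact this (by rw [← h]; abel)
          · rw [Function.update_of_ne hyx, Function.update_of_ne hzx]
            exact hcT y (Finset.mem_erase.mpr ⟨hyx, hy⟩) z (Finset.mem_erase.mpr ⟨hzx, hz⟩) hyz
  obtain ⟨c, hc, hcT⟩ := key _ Finset.univ rfl
  refine ⟨c, hc, fun x y h hxy => ?_⟩
  have := hcT x (Finset.mem_univ _) y (Finset.mem_univ _) hxy
  simpa only [F, dif_pos h] using this

/-- Every nonempty set of edges of a planar graph without five-cycles contains an edge that meets
at most `Δ + 1` others of the set. -/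
theorem IsPlanar.exists_edge_few_neighbors [Fintype V] [DecidableRel G.Adj]
    (hG : G.IsPlanar) (h5 : G.NoFiveCycle) [DecidableRel G.lineGraph.Adj]
    (T : Finset G.edgeSet) (hT : T.Nonempty) :
    ∃ e ∈ T, (T.filter fun e' => G.lineGraph.Adj e e').card < G.maxDegree + 2 := by
  classical
  let H : SimpleGraph V := fromEdgeSet {e | ∃ h : e ∈ G.edgeSet, (⟨e, h⟩ : G.edgeSet) ∈ T}
  have hmem : ∀ e, e ∈ H.edgeSet ↔ ∃ h : e ∈ G.edgeSet, (⟨e, h⟩ : G.edgeSet) ∈ T := by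
    intro e
    simp only [H, edgeSet_fromEdgeSet, Set.mem_sdiff, Set.mem_ofPred_eq]
    exact ⟨fun h => h.1, fun h => ⟨h, G.not_isDiag_of_mem_edgeSet h.1⟩⟩
  have hle : H ≤ G := by
    rw [← edgeSet_subset_edgeSet]
    exact fun e he => ((hmem e).mp he).1
  obtain ⟨⟨e₀, he₀⟩, heT₀⟩ := hT
  obtain ⟨v, hv0, hv3⟩ := (hG.mono hle).exists_degree_le_three (h5.mono hle)
    ⟨e₀, (hmem e₀).mpr ⟨he₀, heT₀⟩⟩
  obtain ⟨w, hvw⟩ := (H.degree_pos_iff_exists_adj v).mp hv0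
  obtain ⟨he, heT⟩ := (hmem s(v, w)).mp hvw
  refine ⟨⟨s(v, w), he⟩, heT, ?_⟩
  -- Without `vw` itself, the edges of `H` number at most 3 - 1 at `v` and Δ - 1 at `w`.
  have hsub : ((T.filter fun e' => G.lineGraph.Adj ⟨s(v, w), he⟩ e').image Subtype.val) ⊆
      (H.incidenceFinset v).erase s(v, w) ∪ (H.incidenceFinset w).erase s(v, w) := by
    intro e' h
    obtain ⟨⟨e', he'⟩, hfil, rfl⟩ := Finset.mem_image.mp h
    obtain ⟨hT', hadj⟩ := Finset.mem_filter.mp hfil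
    rw [lineGraph_adj_iff_exists] at hadj
    obtain ⟨hne, x, hx, hx'⟩ := hadj
    have hne' : e' ≠ s(v, w) := fun h => hne (Subtype.ext h.symm)
    have hH : e' ∈ H.edgeSet := (hmem e').mpr ⟨he', hT'⟩
    rw [Sym2.mem_iff] at hx
    rcases hx with rfl | rfl
    · exact Finset.mem_union_left _ (Finset.mem_erase.mpr
        ⟨hne', (H.mem_incidenceFinset _ _).mpr ⟨hH, hx'⟩⟩)
    · exact Finset.mem_union_right _ (Finset.mem_erase.mpr
        ⟨hne', (H.mem_incidenceFinset _ _).mpr ⟨hH, hx'⟩⟩)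
  have hcard := (Finset.card_le_card hsub).trans (Finset.card_union_le _ _)
  rw [Finset.card_image_of_injective _ Subtype.val_injective,
    Finset.card_erase_of_mem ((H.mem_incidenceFinset _ _).mpr ⟨hvw, Sym2.mem_mk_left _ _⟩),
    Finset.card_erase_of_mem ((H.mem_incidenceFinset _ _).mpr ⟨hvw, Sym2.mem_mk_right _ _⟩),
    card_incidenceFinset_eq_degree, card_incidenceFinset_eq_degree] at hcard
  have hw : H.degree w ≤ G.maxDegree := (degree_le_of_le hle).trans (G.degree_le_maxDegree w)
  have hw0 : 0 < H.degree w := (H.degree_pos_iff_exists_adj w).mpr ⟨v, hvw.symm⟩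
  omega

end SimpleGraph

theorem mainTheorem8 {V : Type u} [Fintype V] (G : SimpleGraph V) [DecidableRel G.Adj]
    (hplanar : G.IsPlanar)
    (hcycle : ∀ (v : V) (p : G.Walk v v), p.IsCycle → p.length ≠ 5) :
    SimpleGraph.IsEdgeGroupChoosable.{u, w} G (G.maxDegree + 2) := by
  classical
  exact SimpleGraph.IsGroupChoosable.of_degenerate G.lineGraph _ fun T hT =>
    hplanar.exists_edge_few_neighbors hcycle T hT
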